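/- A logic circuit is a non-empty connected acyclic directed graph whose nodes are inputs (no incoming and at least one outgoing edge), outputs (exactly one incoming and no outgoing edge) and finitely many gates (with incoming and outgoing edges). Each gate represents a Boolean function of one or two bits, namely AND, OR, XOR, NOT or one of their negations (so NAND, NOR, XNOR and the identity, i.e. a repeater, are allowed). The fan-in (fan-out) of a circuit is the maximum number of incoming (outgoing) edges at a node, the inputs included; its size is the number of gates; its depth is the maximum length of a directed path. An $n$-bit adder is a logic circuit that has as inputs the bits of two $n$-bit numbers $A$ and $B$ and as outputs the $n+1$ bits of $A+B$. **Theorem.** For every integer $n \ge 1$ there is an $n$-bit adder $C_n$ with fan-in at most two and fan-out at most two, such that, as $n \to \infty$, $$\operatorname{depth}(C_n) = \log_2 n + o(\log n) \qquad\text{and}\qquad \operatorname{size}(C_n) = O(n).$$ This depth is asymptotically optimal: for every $n\ge 1$, every $n$-bit adder (without any restriction on its size or fan-out) has depth at least $\log_2 n$. -/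

import Mathlib

/-- The available gates: identity (a repeater), NOT, AND, OR, XOR and the negations of the
latter three. -/
inductive GateKind : Type
  | buf
  | not
  | and
  | nand
  | or
  | nor
  | xor
  | xnor

/-- The number of operands of a gate. -/
def GateKind.arity : GateKind → ℕ
  | .buf => 1
  | .not => 1
  | .and => 2
  | .nand => 2
  | .or => 2
  | .nor => 2
  | .xor => 2
  | .xnor => 2

/-- The Boolean function represented by a gate. -/
def GateKind.eval : (k : GateKind) → (Fin k.arity → Bool) → Bool
  | .buf, x => x (0 : Fin 1)
  | .not, x => !(x (0 : Fin 1))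
  | .and, x => x (0 : Fin 2) && x (1 : Fin 2)
  | .nand, x => !(x (0 : Fin 2) && x (1 : Fin 2))
  | .or, x => x (0 : Fin 2) || x (1 : Fin 2)
  | .nor, x => !(x (0 : Fin 2) || x (1 : Fin 2))
  | .xor, x => Bool.xor (x (0 : Fin 2)) (x (1 : Fin 2))
  | .xnor, x => !(Bool.xor (x (0 : Fin 2)) (x (1 : Fin 2)))

/-- The directed (multi)graph underlying a circuit, with input nodes indexed by `ι`, output nodes
indexed by `ο` and finitely many gates. Every operand of a gate, and every output node, is
connected by one wire to an input node or to a gate. -/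
structure CircuitGraph (ι ο : Type) where
  Gate : Type
  finite_gate : Finite Gate
  kind : Gate → GateKind
  operand : (g : Gate) → Fin (kind g).arity → ι ⊕ Gate
  outputSource : ο → ι ⊕ Gate

namespace CircuitGraph

variable {ι ο : Type} (c : CircuitGraph ι ο)

/-- The nodes of the graph: inputs and gates (left summand), and outputs (right summand). -/
abbrev Vertex : Type := (ι ⊕ c.Gate) ⊕ ο

/-- The edges of the graph: one for each operand of each gate, and one for each output. -/
abbrev Wire : Type := (Σ g : c.Gate, Fin (c.kind g).arity) ⊕ ο

/-- The tail of an edge. -/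
def wireSource : c.Wire → c.Vertex
  | .inl p => .inl (c.operand p.1 p.2)
  | .inr o => .inl (c.outputSource o)

/-- The head of an edge. -/
def wireTarget : c.Wire → c.Vertex
  | .inl p => .inl (.inr p.1)
  | .inr o => .inr o

/-- There is an edge from `u` to `v`. -/
def Adj (u v : c.Vertex) : Prop := ∃ w : c.Wire, c.wireSource w = u ∧ c.wireTarget w = v

/-- The maximum number of incoming edges at a vertex. -/
noncomputable def fanIn : ℕ∞ := ⨆ v : c.Vertex, Set.encard {w : c.Wire | c.wireTarget w = v}

/-- The maximum number of outgoing edges at a vertex (inputs and gates alike); parallel edges are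
counted with multiplicity. -/
noncomputable def fanOut : ℕ∞ := ⨆ v : c.Vertex, Set.encard {w : c.Wire | c.wireSource w = v}

/-- The maximum length (number of edges) of a directed path. -/
noncomputable def depth : ℕ∞ :=
  ⨆ p : RelSeries {e : c.Vertex × c.Vertex | c.Adj e.1 e.2}, (p.length : ℕ∞)

/-- The number of gates. -/
noncomputable def size : ℕ := Nat.card c.Gate

/-- There are no directed cycles. -/
def Acyclic : Prop := ∀ v : c.Vertex, ¬ Relation.TransGen c.Adj v v

/-- The gate `g` is an operand of the gate `h`. -/
def Feeds (g h : c.Gate) : Prop := ∃ i, c.operand h i = Sum.inr g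

theorem Acyclic.wellFounded_feeds {c : CircuitGraph ι ο} (hc : c.Acyclic) :
    WellFounded c.Feeds := by
  have := c.finite_gate
  let v : c.Gate → c.Vertex := fun g => Sum.inl (Sum.inr g)
  have key : ∀ g h, c.Feeds g h → c.Adj (v g) (v h) := by
    rintro g h ⟨i, hi⟩
    exact ⟨Sum.inl ⟨h, i⟩, by simp [wireSource, hi, v], rfl⟩
  let r : c.Gate → c.Gate → Prop := fun g h => Relation.TransGen c.Adj (v g) (v h)
  have : IsTrans c.Gate r := ⟨fun _ _ _ h₁ h₂ => Relation.TransGen.trans h₁ h₂⟩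
  have : Std.Irrefl r := ⟨fun g => hc (v g)⟩
  exact Subrelation.wf (fun {g h} hgh => Relation.TransGen.single (key g h hgh))
    (Finite.wellFounded_of_trans_of_irrefl r)

end CircuitGraph

/-- A logic circuit: a connected (in particular non-empty) acyclic graph in which every input and
every gate has an outgoing edge. (Gates have at least one incoming edge, and outputs exactly one
incoming and no outgoing edge, by construction.) -/
structure LogicCircuit (ι ο : Type) extends CircuitGraph ι ο where
  acyclic : toCircuitGraph.Acyclic
  exists_outgoing : ∀ u : ι ⊕ toCircuitGraph.Gate,
    ∃ w, toCircuitGraph.wireSource w = Sum.inl u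
  connected : (SimpleGraph.fromRel toCircuitGraph.Adj).Connected

namespace LogicCircuit

variable {ι ο : Type} (c : LogicCircuit ι ο)

/-- The value of each gate when the inputs have the values `x`. -/
noncomputable def gateValue (x : ι → Bool) : c.Gate → Bool :=
  c.acyclic.wellFounded_feeds.fix fun g rec =>
    (c.kind g).eval fun i =>
      match h : c.operand g i with
      | .inl j => x j
      | .inr g' => rec g' ⟨i, h⟩

/-- The values of the outputs when the inputs have the values `x`. -/
noncomputable def eval (x : ι → Bool) (o : ο) : Bool :=
  Sum.elim x (c.gateValue x) (c.outputSource o)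

/-- A gate computes its Boolean function of the values of its operands. -/
theorem gateValue_eq (x : ι → Bool) (g : c.Gate) :
    c.gateValue x g =
      (c.kind g).eval fun i => Sum.elim x (c.gateValue x) (c.operand g i) := by
  unfold gateValue
  rw [WellFounded.fix_eq]
  congr 1
  funext i
  split <;> rename_i h <;> simp [h]

end LogicCircuit

/-- The circuit computes the `n + 1` bits of the sum of two `n`-bit numbers; in each number the
bit with index `i` has weight `2 ^ i`. -/
def IsAdder (n : ℕ) (c : LogicCircuit (Fin n ⊕ Fin n) (Fin (n + 1))) : Prop :=
  ∀ a b : Fin n → Bool,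
    Nat.ofBits (c.eval (Sum.elim a b)) = Nat.ofBits a + Nat.ofBits b

/-!
Lower bound: when one of the two numbers is `2 ^ n - 1`, there is a carry into position `n` if and
only if the other number is not zero. So the last output depends on each of the `2 * n` inputs, and
there is a path to it from each of them. As gates have at most two operands, one of these paths has
length at least `log₂ (2 * n)` (`CircuitGraph.exists_path_of_lt_ncard`).

Upper bound: circuits are not written down as graphs. Instead, a *token* is a Boolean function of
the inputs with a time at which it is available, to be used by one wire only. A gate consumes its
operands and offers two tokens for its result, one time unit later; this builds in the fan-out
bound. `Derives s A B` says that the multiset `A` of tokens can be turned into `B` with at most `s`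
gates. Derivations can be composed, put side by side and framed, and if the tokens for the outputs
can be derived from two tokens for each input, then there is a logic circuit, obtained by removing
the gates from which no output is reached (`Realizable.exists_logicCircuit`). It is connected since
the last output depends on all inputs.

The `n` positions are divided into blocks of `2 ^ h` positions. Inside a block, a binary tree
computes, with linear size and depth `O(h)`, whether the block generates or propagates a carry, and,
in a second pass, turns the carry into the block into the digits of the sum (`exists_carryTree`).
The carries into the blocks are computed in `k` rounds. After round `t`, the signal `H i` says
whether a carry is generated in the `r ^ t` blocks that end in block `i`, where `r = 2 ^ m`, and
`W i` says whether all these blocks propagate carries. A round replaces `H i` by the disjunction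
over `j < r` of `H (i - j * r ^ t)` and the conjunction of `W (i - l * r ^ t)` over `l < j`
(`Derives.windowTokens_mul`). Two observations keep its delay down to `m + 1` instead of `2 * m` or
more. The signals `W` do not depend on the signals `H`, so that the conjunctions can be prepared in
advance. And the `r` copies of the new signal that the next round consumes need no repeaters: a
butterfly of `OR` gates, each with fan-out two, delivers `r` copies of the disjunction of `r` signals
after `m` steps (`Derives.butterfly_or`). Indices of blocks are taken modulo the number of blocks;
declaring the first block not to propagate carries makes the windows that wrap around harmless.

With `m ≈ log₂ n / k` and `h = 4 * m`, the total depth is `log₂ n + O(log₂ n / k + k)`, and the size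
is at most `42 * n` as soon as `n` is large in terms of `k` (`exists_adder_depth_le`); a single tree
is an adder of linear size for all `n` (`exists_adder_size_le`). Since the constant `42` does not
depend on `k`, adders of minimum depth among those of size at most `42 * n` have depth
`log₂ n + o(log n)`.
-/

/-! ### Partial circuits as multisets of tokens -/

/-- A Boolean function of the inputs, together with a time by which it is available. -/
abbrev Token (ι : Type) : Type := ((ι → Bool) → Bool) × ℕ

/-- `Realizable s M`: some partial circuit with at most `s` gates offers the tokens in `M`, each of
them to be used by at most one further wire. The sources (inputs and gates) carry their values
`val` and strictly increasing ranks; `free` lists the unused wires, each with a time that is at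
least the rank of its source. Wires in use and unused wires together make up a fan-out of at most
two at every source. -/
def Realizable {ι : Type} (s : ℕ) (M : Multiset (Token ι)) : Prop :=
  ∃ (Gate : Type) (_ : Fintype Gate) (kind : Gate → GateKind)
    (operand : (g : Gate) → Fin (kind g).arity → ι ⊕ Gate)
    (val : ι ⊕ Gate → (ι → Bool) → Bool) (rank : ι ⊕ Gate → ℕ)
    (free : Multiset ((ι ⊕ Gate) × ℕ)),
    Fintype.card Gate ≤ s ∧
    (∀ i x, val (.inl i) x = x i) ∧
    (∀ g x, val (.inr g) x = (kind g).eval fun i => val (operand g i) x) ∧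
    (∀ g i, rank (operand g i) < rank (.inr g)) ∧
    (∀ w ∈ free, rank w.1 ≤ w.2) ∧
    (∀ (_ : DecidableEq (ι ⊕ Gate)) (u : ι ⊕ Gate), Multiset.count u
      ((∑ g, ∑ i, {operand g i}) + free.map Prod.fst) ≤ 2) ∧
    M = free.map fun w => (val w.1, w.2)

/-- `Derives s A B`: in the presence of any further tokens, the tokens in `A` can be turned into
those in `B` with at most `s` additional gates. -/
def Derives {ι : Type} (s : ℕ) (A B : Multiset (Token ι)) : Prop :=
  ∀ s₀ R, Realizable s₀ (A + R) → Realizable (s₀ + s) (B + R)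

theorem Multiset.exists_of_map_eq_cons {α β : Type*} (f : α → β) {A : Multiset α} {b : β}
    {R : Multiset β} (h : A.map f = b ::ₘ R) :
    ∃ (a : α) (A' : Multiset α), A = a ::ₘ A' ∧ f a = b ∧ A'.map f = R := by
  classical
  obtain ⟨a, ha, hfa, hA⟩ := (Multiset.map_eq_cons f A R b).2 h
  exact ⟨a, A.erase a, (Multiset.cons_erase ha).symm, hfa, hA⟩

theorem Multiset.exists_of_map_eq_sum_add {α β : Type*} (f : α → β) {n : ℕ} (x : Fin n → β)
    (A : Multiset α) (R : Multiset β) (h : A.map f = ∑ i, {x i} + R) :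
    ∃ (u : Fin n → α) (A' : Multiset α),
      A = ∑ i, {u i} + A' ∧ (∀ i, f (u i) = x i) ∧ A'.map f = R := by
  classical
  induction n generalizing A with
  | zero => exact ⟨Fin.elim0, A, by simp, fun i => i.elim0, by simpa using h⟩
  | succ n ih =>
    rw [Fin.sum_univ_succ, add_assoc, Multiset.singleton_add] at h
    obtain ⟨a, A₁, rfl, hfa, hA⟩ := Multiset.exists_of_map_eq_cons f h
    obtain ⟨u, A', rfl, hfu, hA'⟩ := ih (fun i => x i.succ) _ hA
    refine ⟨Fin.cons a u, A', ?_, ?_, hA'⟩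
    · rw [Fin.sum_univ_succ, add_assoc, Multiset.singleton_add]
      simp only [Fin.cons_zero, Fin.cons_succ]
    · intro i
      refine Fin.cases ?_ (fun i => ?_) i
      · simpa using hfa
      · simpa using hfu i

theorem Realizable.mono {ι : Type} {s s' : ℕ} {M : Multiset (Token ι)} (h : Realizable s M)
    (hs : s ≤ s') : Realizable s' M := by
  obtain ⟨Gate, i, kind, operand, val, rank, free, h1, h2⟩ := h
  exact ⟨Gate, i, kind, operand, val, rank, free, h1.trans hs, h2⟩

theorem realizable_inputs (ι : Type) [Fintype ι] :
    Realizable 0 (∑ i : ι, 2 • ({(fun x => x i, 0)} : Multiset (Token ι))) := by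
  classical
  refine ⟨Empty, inferInstance, Empty.elim, fun g => g.elim,
    Sum.elim (fun i x => x i) (fun g => g.elim), fun _ => 0,
    ∑ i : ι, 2 • {(.inl i, 0)}, by simp, by simp, fun g => g.elim, fun g => g.elim,
    by simp, ?_, ?_⟩
  · rintro _ (u | u)
    · have : (∑ i : ι, 2 • ({((.inl i : ι ⊕ Empty), 0)} : Multiset (_ × ℕ))).map Prod.fst =
          ∑ i : ι, 2 • {.inl i} := by
        rw [← Multiset.coe_mapAddMonoidHom, map_sum]
        simp [Multiset.nsmul_singleton]
      rw [this, Finset.univ_eq_empty, Finset.sum_empty, zero_add, Multiset.count_sum',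
        Finset.sum_eq_single u (fun v _ hv => ?_) (by simp)]
      · simp [Multiset.nsmul_singleton]
      · simp [Multiset.nsmul_singleton, hv.symm]
    · exact u.elim
  · rw [← Multiset.coe_mapAddMonoidHom, map_sum]
    simp [Multiset.nsmul_singleton]

theorem Realizable.of_add {ι : Type} {s : ℕ} {M M' : Multiset (Token ι)}
    (h : Realizable s (M' + M)) : Realizable s M := by
  induction M' using Multiset.induction_on with
  | empty => simpa using h
  | cons x M' ih =>
    refine ih ?_
    obtain ⟨Gate, i, kind, operand, val, rank, free, h1, h2, h3, h4, h5, h6, h7⟩ := h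
    rw [Multiset.cons_add] at h7
    obtain ⟨w, free', rfl, -, hA⟩ := Multiset.exists_of_map_eq_cons _ h7.symm
    refine ⟨Gate, i, kind, operand, val, rank, free', h1, h2, h3, h4,
      fun w hw => h5 w (Multiset.mem_cons_of_mem hw), fun inst u => le_trans ?_ (h6 inst u),
      hA.symm⟩
    exact Multiset.count_le_of_le _
      (add_le_add_right (Multiset.map_le_map (Multiset.le_cons_self _ _)) _)

theorem Realizable.delay {ι : Type} {s : ℕ} {M : Multiset (Token ι)} {x : (ι → Bool) → Bool}
    {t t' : ℕ} (ht : t ≤ t') (h : Realizable s ({(x, t)} + M)) :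
    Realizable s ({(x, t')} + M) := by
  obtain ⟨Gate, i, kind, operand, val, rank, free, h1, h2, h3, h4, h5, h6, h7⟩ := h
  rw [Multiset.singleton_add] at h7
  obtain ⟨⟨u, v⟩, free', rfl, hfa, rfl⟩ := Multiset.exists_of_map_eq_cons _ h7.symm
  simp only [Prod.mk.injEq] at hfa
  obtain ⟨rfl, rfl⟩ := hfa
  refine ⟨Gate, i, kind, operand, val, rank, (u, t') ::ₘ free', h1, h2, h3, h4, ?_, ?_, ?_⟩
  · intro w hw
    rcases Multiset.mem_cons.1 hw with rfl | hw
    · exact (h5 (u, v) (Multiset.mem_cons_self _ _)).trans ht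
    · exact h5 _ (Multiset.mem_cons_of_mem hw)
  · simpa only [Multiset.map_cons] using h6
  · simp

/-- Adding a gate: its operands are used up, and its value is available on two wires. -/
theorem Realizable.gate {ι : Type} {s : ℕ} {M : Multiset (Token ι)} (k : GateKind)
    (x : Fin k.arity → (ι → Bool) → Bool) (τ : Fin k.arity → ℕ) (t : ℕ) (hτ : ∀ i, τ i ≤ t)
    (h : Realizable s (∑ i, {(x i, τ i)} + M)) :
    Realizable (s + 1) (2 • {(fun a => k.eval fun i => x i a, t + 1)} + M) := by
  classical
  obtain ⟨Gate, i, kind, operand, val, rank, free, h1, h2, h3, h4, h5, h6, h7⟩ := h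
  obtain ⟨u, free', rfl, hu, rfl⟩ :=
    Multiset.exists_of_map_eq_sum_add _ (fun i => (x i, τ i)) free M h7.symm
  simp only [Prod.mk.injEq] at hu
  let emb : ι ⊕ Gate → ι ⊕ Option Gate := Sum.map id some
  have emb_inj : Function.Injective emb :=
    Function.injective_id.sumMap (Option.some_injective _)
  let kind' : Option Gate → GateKind
    | none => k
    | some g => kind g
  let operand' : (g : Option Gate) → Fin (kind' g).arity → ι ⊕ Option Gate
    | none, i => emb (u i).1
    | some g, i => emb (operand g i)
  let val' : ι ⊕ Option Gate → (ι → Bool) → Bool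
    | .inl i => val (.inl i)
    | .inr (some g) => val (.inr g)
    | .inr none => fun a => k.eval fun i => x i a
  let rank' : ι ⊕ Option Gate → ℕ
    | .inl i => rank (.inl i)
    | .inr (some g) => rank (.inr g)
    | .inr none => t + 1
  have hval : ∀ v, val' (emb v) = val v := by rintro (v | v) <;> rfl
  have hrank : ∀ v, rank' (emb v) = rank v := by rintro (v | v) <;> rfl
  refine ⟨Option Gate, inferInstance, kind', operand', val', rank',
    2 • {(.inr none, t + 1)} + free'.map (fun w => (emb w.1, w.2)), by simpa using h1, h2,
    ?_, ?_, ?_, ?_, ?_⟩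
  · rintro (_ | g) a
    · change k.eval _ = k.eval fun i => val' (emb (u i).1) a
      congr 1
      funext i
      rw [hval, (hu i).1]
    · change val (.inr g) a = (kind g).eval fun i => val' (emb (operand g i)) a
      simp only [hval]
      exact h3 g a
  · rintro (_ | g) i
    · change rank' (emb (u i).1) < t + 1
      rw [hrank]
      have := h5 (u i) (Multiset.mem_add.2 (Or.inl (Multiset.mem_sum.2 ⟨i, by simp⟩)))
      have := (hu i).2
      have := hτ i
      omega
    · change rank' (emb (operand g i)) < rank' (emb (.inr g))
      rw [hrank, hrank]
      exact h4 g i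
  · intro w hw
    rcases Multiset.mem_add.1 hw with hw | hw
    · rw [Multiset.nsmul_singleton, Multiset.mem_replicate] at hw
      rw [hw.2]
    · obtain ⟨w', hw', rfl⟩ := Multiset.mem_map.1 hw
      simp only [hrank]
      exact h5 w' (Multiset.mem_add.2 (Or.inr hw'))
  · have key : (∑ g, ∑ i, {operand' g i}) + (2 • {((.inr none : ι ⊕ Option Gate), t + 1)} +
        free'.map (fun w : (ι ⊕ Gate) × ℕ => (emb w.1, w.2))).map Prod.fst =
        2 • {.inr none} + ((∑ g, ∑ i, {operand g i}) +
          (∑ i, {u i} + free').map Prod.fst).map emb := by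
      have e1 : (∑ g, ∑ i, ({operand' g i} : Multiset (ι ⊕ Option Gate))) =
          ∑ i, {emb (u i).1} + ∑ g, ∑ i, {emb (operand g i)} := Fintype.sum_option _
      rw [e1]
      simp only [Multiset.map_add, Multiset.map_nsmul,
        ← Multiset.coe_mapAddMonoidHom, map_sum]
      simp only [Multiset.coe_mapAddMonoidHom, Multiset.map_singleton, Multiset.map_map,
        Function.comp_def]
      abel
    intro _ v
    rw [key, Multiset.count_add]
    by_cases hv : ∃ v', emb v' = v
    · obtain ⟨v', rfl⟩ := hv
      rw [Multiset.count_map_eq_count' _ _ emb_inj]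
      have : Multiset.count (emb v') (2 • {(.inr none : ι ⊕ Option Gate)}) = 0 := by
        rw [Multiset.count_eq_zero, Multiset.nsmul_singleton, Multiset.mem_replicate]
        rcases v' with v' | v' <;> simp [emb]
      have := h6 inferInstance v'
      omega
    · have : Multiset.count v (((∑ g, ∑ i, {operand g i}) +
          (∑ i, {u i} + free').map Prod.fst).map emb) = 0 := by
        rw [Multiset.count_eq_zero, Multiset.mem_map]
        rintro ⟨v', -, h⟩
        exact hv ⟨v', h⟩
      rw [this, Multiset.nsmul_singleton, Multiset.count_replicate]
      split <;> simp
  · simp [val', hval, Multiset.nsmul_singleton]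

namespace Derives

variable {ι : Type} {s s' : ℕ} {A B C D : Multiset (Token ι)}

theorem refl (A : Multiset (Token ι)) : Derives 0 A A := fun _ _ h => h

theorem trans (h : Derives s A B) (h' : Derives s' B C) : Derives (s + s') A C := by
  intro s₀ R hR
  rw [← add_assoc]
  exact h' _ _ (h _ _ hR)

theorem mono (h : Derives s A B) (hs : s ≤ s') : Derives s' A B :=
  fun _ _ hR => (h _ _ hR).mono (by omega)

theorem add (h : Derives s A B) (h' : Derives s' C D) : Derives (s + s') (A + C) (B + D) := by
  intro s₀ R hR
  rw [add_assoc] at hR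
  have h1 := h _ _ hR
  rw [add_left_comm] at h1
  have h2 := h' _ _ h1
  rw [add_left_comm, ← add_assoc, add_assoc s₀] at h2
  exact h2

theorem add_right (h : Derives s A B) (R : Multiset (Token ι)) : Derives s (A + R) (B + R) :=
  h.add (refl R)

theorem add_left (h : Derives s A B) (R : Multiset (Token ι)) : Derives s (R + A) (R + B) := by
  simpa using (refl R).add h

theorem sum {κ : Type*} (S : Finset κ) {f : κ → ℕ} {A B : κ → Multiset (Token ι)}
    (h : ∀ i ∈ S, Derives (f i) (A i) (B i)) :
    Derives (∑ i ∈ S, f i) (∑ i ∈ S, A i) (∑ i ∈ S, B i) := by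
  classical
  induction S using Finset.induction_on with
  | empty => simpa using refl 0
  | insert i S hi ih =>
    rw [Finset.sum_insert hi, Finset.sum_insert hi, Finset.sum_insert hi]
    exact (h i (by simp)).add (ih fun j hj => h j (by simp [hj]))

theorem nsmul (n : ℕ) (h : Derives s A B) : Derives (n * s) (n • A) (n • B) := by
  simpa using sum (Finset.range n) (fun _ _ => h)

theorem of_le (h : B ≤ A) : Derives 0 A B :=
  fun s₀ R hR => by
    obtain ⟨C, rfl⟩ := Multiset.le_iff_exists_add.1 h
    rw [add_comm B, add_assoc] at hR
    exact hR.of_add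

theorem of_eq (h : A = B) : Derives 0 A B := h ▸ refl A

theorem delay (x : (ι → Bool) → Bool) {t t' : ℕ} (ht : t ≤ t') :
    Derives 0 {(x, t)} {(x, t')} :=
  fun _ _ hR => hR.delay ht

theorem buf (x : (ι → Bool) → Bool) (t : ℕ) : Derives 1 {(x, t)} (2 • {(x, t + 1)}) := by
  intro s₀ R hR
  exact Realizable.gate .buf (fun _ => x) (fun _ => t) t (fun _ => le_rfl)
    (by
      change Realizable s₀ (∑ _i : Fin 1, {(x, t)} + R)
      simpa using hR)

theorem binary (k : GateKind) (hk : k.arity = 2) (x y : (ι → Bool) → Bool) {t₁ t₂ t : ℕ}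
    (h₁ : t₁ ≤ t) (h₂ : t₂ ≤ t) :
    Derives 1 ({(x, t₁)} + {(y, t₂)})
      (2 • {(fun a => k.eval fun i => (![x, y] (Fin.cast hk i)) a, t + 1)}) := by
  intro s₀ R hR
  refine Realizable.gate k (fun i => ![x, y] (Fin.cast hk i))
    (fun i => ![t₁, t₂] (Fin.cast hk i)) t ?_ ?_
  · intro i
    generalize Fin.cast hk i = j
    fin_cases j <;> assumption
  · rw [← Equiv.sum_comp (finCongr hk).symm]
    simpa [Fin.sum_univ_two] using hR

theorem and (x y : (ι → Bool) → Bool) {t₁ t₂ t : ℕ} (h₁ : t₁ ≤ t) (h₂ : t₂ ≤ t) :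
    Derives 1 ({(x, t₁)} + {(y, t₂)}) (2 • {(fun a => x a && y a, t + 1)}) :=
  binary .and rfl x y h₁ h₂

theorem or (x y : (ι → Bool) → Bool) {t₁ t₂ t : ℕ} (h₁ : t₁ ≤ t) (h₂ : t₂ ≤ t) :
    Derives 1 ({(x, t₁)} + {(y, t₂)}) (2 • {(fun a => x a || y a, t + 1)}) :=
  binary .or rfl x y h₁ h₂

theorem xor (x y : (ι → Bool) → Bool) {t₁ t₂ t : ℕ} (h₁ : t₁ ≤ t) (h₂ : t₂ ≤ t) :
    Derives 1 ({(x, t₁)} + {(y, t₂)}) (2 • {(fun a => Bool.xor (x a) (y a), t + 1)}) :=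
  binary .xor rfl x y h₁ h₂

theorem xnor (x y : (ι → Bool) → Bool) {t₁ t₂ t : ℕ} (h₁ : t₁ ≤ t) (h₂ : t₂ ≤ t) :
    Derives 1 ({(x, t₁)} + {(y, t₂)}) (2 • {(fun a => !(Bool.xor (x a) (y a)), t + 1)}) :=
  binary .xnor rfl x y h₁ h₂

end Derives

/-! ### Copying and combining many tokens -/

namespace Derives

variable {ι : Type}

/-- A binary tree of repeaters. -/
theorem dup (x : (ι → Bool) → Bool) (t m : ℕ) :
    Derives (2 ^ m) {(x, t)} (2 ^ m • {(x, t + m)}) := by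
  induction m with
  | zero => simpa using (refl {(x, t)}).mono (Nat.zero_le 1)
  | succ m ih =>
    have h := ih.trans ((buf x (t + m)).nsmul (2 ^ m))
    rw [← mul_nsmul', ← pow_succ] at h
    exact h.mono (by rw [pow_succ]; omega)

/-- A butterfly network of `OR` gates turns `2 ^ m` signals into `2 ^ m` copies of their
disjunction. Since every `OR` gate contributes to the merging of the signals and, by its fan-out of
two, also to the distribution of the result, the distribution causes no extra delay. -/
theorem butterfly_or (m : ℕ) (x : ℕ → (ι → Bool) → Bool) (t : ℕ) :
    Derives (2 ^ m * 2 ^ m) (∑ j ∈ Finset.range (2 ^ m), {(x j, t)})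
      (2 ^ m • {(fun a => decide (∃ j < 2 ^ m, x j a = true), t + m)}) := by
  induction m generalizing x with
  | zero =>
    have : (fun a => decide (∃ j < 2 ^ 0, x j a = true)) = x 0 := by funext a; simp
    rw [this]
    simpa using (refl {(x 0, t)}).mono (Nat.zero_le 1)
  | succ m ih =>
    have h := ((ih x).add (ih fun j => x (2 ^ m + j))).trans
      (((of_eq (nsmul_add _ _ _).symm).trans
        ((or _ _ (le_refl (t + m)) (le_refl (t + m))).nsmul (2 ^ m))))
    rw [← Finset.sum_range_add fun j => ({(x j, t)} : Multiset (Token ι)), ← mul_nsmul',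
      ← pow_succ] at h
    have e : (fun a => decide (∃ j < 2 ^ m, x j a = true) ||
        decide (∃ j < 2 ^ m, x (2 ^ m + j) a = true)) =
        fun a => decide (∃ j < 2 ^ (m + 1), x j a = true) := by
      funext a
      rw [Bool.eq_iff_iff]
      simp only [Bool.or_eq_true, decide_eq_true_eq, pow_succ]
      constructor
      · rintro (⟨j, hj, h⟩ | ⟨j, hj, h⟩)
        · exact ⟨j, by omega, h⟩
        · exact ⟨_, by omega, h⟩
      · rintro ⟨j, hj, h⟩
        by_cases hjm : j < 2 ^ m
        · exact .inl ⟨j, hjm, h⟩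
        · exact .inr ⟨j - 2 ^ m, by omega, by rwa [Nat.add_sub_cancel' (by omega)]⟩
    rw [e, ← Nat.two_pow_succ] at h
    refine h.mono ?_
    have : 0 < 2 ^ m := by positivity
    rw [pow_succ]
    nlinarith

theorem butterfly_and (m : ℕ) (x : ℕ → (ι → Bool) → Bool) (t : ℕ) :
    Derives (2 ^ m * 2 ^ m) (∑ j ∈ Finset.range (2 ^ m), {(x j, t)})
      (2 ^ m • {(fun a => decide (∀ j < 2 ^ m, x j a = true), t + m)}) := by
  induction m generalizing x with
  | zero =>
    have : (fun a => decide (∀ j < 2 ^ 0, x j a = true)) = x 0 := by funext a; simp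
    rw [this]
    simpa using (refl {(x 0, t)}).mono (Nat.zero_le 1)
  | succ m ih =>
    have h := ((ih x).add (ih fun j => x (2 ^ m + j))).trans
      (((of_eq (nsmul_add _ _ _).symm).trans
        ((and _ _ (le_refl (t + m)) (le_refl (t + m))).nsmul (2 ^ m))))
    rw [← Finset.sum_range_add fun j => ({(x j, t)} : Multiset (Token ι)), ← mul_nsmul',
      ← pow_succ] at h
    have e : (fun a => decide (∀ j < 2 ^ m, x j a = true) &&
        decide (∀ j < 2 ^ m, x (2 ^ m + j) a = true)) =
        fun a => decide (∀ j < 2 ^ (m + 1), x j a = true) := by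
      funext a
      rw [Bool.eq_iff_iff]
      simp only [Bool.and_eq_true, decide_eq_true_eq, pow_succ]
      constructor
      · rintro ⟨h₁, h₂⟩ j hj
        by_cases hjm : j < 2 ^ m
        · exact h₁ j hjm
        · have := h₂ (j - 2 ^ m) (by omega)
          rwa [Nat.add_sub_cancel' (by omega)] at this
      · exact fun h => ⟨fun j hj => h j (by omega), fun j hj => h _ (by omega)⟩
    rw [e, ← Nat.two_pow_succ] at h
    refine h.mono ?_
    have : 0 < 2 ^ m := by positivity
    rw [pow_succ]
    nlinarith

theorem nsmul_one {x : Token ι} {n : ℕ} (hn : 1 ≤ n) : Derives 0 (n • {x}) {x} :=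
  of_le (by simpa using nsmul_le_nsmul_left (zero_le : 0 ≤ ({x} : Multiset (Token ι))) hn)

end Derives

/-! ### Carry windows -/

section Windows

variable {Γ : Type} [AddCommGroup Γ]

/-- All of the `ℓ` positions `i, i - e, …, i - (ℓ - 1) • e` propagate. -/
def windowPropagate (P : Γ → Bool) (e : Γ) (ℓ : ℕ) (i : Γ) : Bool :=
  decide (∀ u < ℓ, P (i - u • e) = true)

/-- One of the `ℓ` positions `i, i - e, …, i - (ℓ - 1) • e` generates a carry which all positions
between it and `i`, inclusively, propagate. -/
def windowGenerate (G P : Γ → Bool) (e : Γ) (ℓ : ℕ) (i : Γ) : Bool :=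
  decide (∃ u < ℓ, G (i - u • e) = true ∧ ∀ v < u, P (i - v • e) = true)

theorem windowPropagate_mul (P : Γ → Bool) (e : Γ) (r ℓ : ℕ) (i : Γ) :
    windowPropagate P e (r * ℓ) i =
      decide (∀ j < r, windowPropagate P e ℓ (i - j • ℓ • e) = true) := by
  rw [Bool.eq_iff_iff]
  simp only [windowPropagate, decide_eq_true_eq, sub_sub, ← mul_smul, ← add_smul]
  constructor
  · intro h j hj u hu
    refine h _ ?_
    calc j * ℓ + u < (j + 1) * ℓ := by rw [add_mul]; omega
      _ ≤ r * ℓ := Nat.mul_le_mul_right _ hj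
  · intro h u hu
    have hℓ : 0 < ℓ := Nat.pos_of_ne_zero (by rintro rfl; simp at hu)
    have := h (u / ℓ) (Nat.div_lt_of_lt_mul (by rwa [mul_comm])) (u % ℓ) (Nat.mod_lt _ hℓ)
    rwa [Nat.div_add_mod'] at this

/-- A window of `r * ℓ` positions is split into `r` windows of `ℓ` positions: a carry is generated
in one of them and propagated by those above it. -/
theorem windowGenerate_mul (G P : Γ → Bool) (e : Γ) (r ℓ : ℕ) (i : Γ) :
    windowGenerate G P e (r * ℓ) i =
      decide (∃ j < r, (windowGenerate G P e ℓ (i - j • ℓ • e) && decide (∀ l < r,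
        (if l < j then windowPropagate P e ℓ (i - l • ℓ • e) else true) = true)) = true) := by
  rw [Bool.eq_iff_iff]
  simp only [windowGenerate, windowPropagate, Bool.and_eq_true, decide_eq_true_eq, sub_sub,
    ← mul_smul, ← add_smul]
  constructor
  · rintro ⟨u, hu, hG, hP⟩
    have hℓ : 0 < ℓ := Nat.pos_of_ne_zero (by rintro rfl; simp at hu)
    refine ⟨u / ℓ, Nat.div_lt_of_lt_mul (by rwa [mul_comm]), ⟨u % ℓ, Nat.mod_lt _ hℓ, ?_, ?_⟩, ?_⟩
    · rwa [Nat.div_add_mod']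
    · intro v hv
      refine hP _ ?_
      have := Nat.div_add_mod' u ℓ
      omega
    · intro l _
      split_ifs with hl
      · rw [decide_eq_true_eq]
        intro v hv
        refine hP _ ?_
        calc l * ℓ + v < (l + 1) * ℓ := by rw [add_mul]; omega
          _ ≤ u / ℓ * ℓ := Nat.mul_le_mul_right _ hl
          _ ≤ u := Nat.div_mul_le_self _ _
      · rfl
  · rintro ⟨j, hj, ⟨u, hu, hG, hP⟩, hW⟩
    refine ⟨j * ℓ + u, ?_, hG, fun v hv => ?_⟩
    · calc j * ℓ + u < (j + 1) * ℓ := by rw [add_mul]; omega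
        _ ≤ r * ℓ := Nat.mul_le_mul_right _ hj
    · have hℓ : 0 < ℓ := by omega
      by_cases hvj : v < j * ℓ
      · have hl : v / ℓ < j := Nat.div_lt_of_lt_mul (by rwa [mul_comm])
        have := hW (v / ℓ) (hl.trans hj)
        rw [if_pos hl, decide_eq_true_eq] at this
        have := this (v % ℓ) (Nat.mod_lt _ hℓ)
        rwa [Nat.div_add_mod'] at this
      · have := hP (v - j * ℓ) (by omega)
        rwa [Nat.add_sub_cancel' (by omega)] at this

variable [Fintype Γ]

theorem sum_nsmul_eq_sum_sum_sub {M : Type*} [AddCommMonoid M] (n : ℕ) (f : Γ → M) (c : ℕ → Γ) :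
    ∑ i, n • f i = ∑ i, ∑ j ∈ Finset.range n, f (i - c j) := by
  rw [Finset.sum_comm]
  have : ∀ j, ∑ i, f (i - c j) = ∑ i, f i := fun j => Equiv.sum_comp (Equiv.subRight (c j)) f
  simp only [this, Finset.sum_const, Finset.card_range, Finset.smul_sum]

/-- For every position `i`, there are `2 ^ m` tokens for the carry generated in the window of length
`ℓ` that ends in `i`, and `2 ^ m` tokens saying whether that window propagates carries. -/
def windowTokens {ι : Type} (G P : Γ → (ι → Bool) → Bool) (e : Γ) (m ℓ σ τ : ℕ) :
    Multiset (Token ι) :=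
  ∑ i, 2 ^ m • {(fun a => windowGenerate (G · a) (P · a) e ℓ i, σ)} +
    ∑ i, 2 ^ m • {(fun a => windowPropagate (P · a) e ℓ i, τ)}

namespace Derives

variable {ι : Type}

/-- Conjunctions of the initial segments of the sequences `l ↦ W (i - c l)`. -/
theorem masks (m : ℕ) (W : Γ → (ι → Bool) → Bool) (c : ℕ → Γ) (t : ℕ) :
    Derives (Fintype.card Γ * (2 * (2 ^ m * 2 ^ m * 2 ^ m)))
      (∑ i, (2 ^ m * 2 ^ (m + 2)) • {(W i, t)})
      (∑ i, ∑ j ∈ Finset.range (2 ^ m), {(fun a => decide (∀ l < 2 ^ m,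
        (if l < j then W (i - c l) a else true) = true), t + 1 + m)}) := by
  -- the constant `true` is available as the `XNOR` of two copies of `W i`
  have mask (i : Γ) (j l : ℕ) : Derives 1 ({(W (i - c l), t)} + 2 • {(W i, t)})
      {(fun a => if l < j then W (i - c l) a else true, t + 1)} := by
    split_ifs with h
    · exact ((of_le (Multiset.le_add_right _ _)).trans (delay _ (Nat.le_succ t))).mono (by simp)
    · have h := (of_le (Multiset.le_add_left (2 • {(W i, t)}) {(W (i - c l), t)})).trans
        ((of_eq (two_nsmul {(W i, t)})).trans
          ((xnor (W i) (W i) (le_refl t) (le_refl t)).trans (nsmul_one one_le_two)))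
      simpa using h
  have step (i : Γ) := sum (Finset.range (2 ^ m)) fun j _ =>
    (sum (Finset.range (2 ^ m)) fun l _ => mask i j l).trans
      ((butterfly_and m (fun l a => if l < j then W (i - c l) a else true) (t + 1)).trans
        (nsmul_one Nat.one_le_two_pow))
  have h := sum Finset.univ fun i _ => step i
  have e : ∑ i, (2 ^ m * 2 ^ (m + 2)) • ({(W i, t)} : Multiset (Token ι)) =
      ∑ i, ∑ j ∈ Finset.range (2 ^ m), ∑ l ∈ Finset.range (2 ^ m),
        ({(W (i - c l), t)} + 2 • {(W i, t)}) + ∑ i, (2 ^ m * 2 ^ m) • {(W i, t)} := by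
    have e₁ : ∑ i, ∑ j ∈ Finset.range (2 ^ m), ∑ l ∈ Finset.range (2 ^ m),
        ({(W (i - c l), t)} : Multiset (Token ι)) = ∑ i, (2 ^ m * 2 ^ m) • {(W i, t)} := by
      simp only [Finset.sum_const, Finset.card_range]
      rw [← Finset.smul_sum, ← sum_nsmul_eq_sum_sum_sub _ (fun i => {(W i, t)}) c, Finset.smul_sum]
      simp only [mul_smul]
    simp only [Finset.sum_add_distrib]
    rw [e₁]
    simp only [Finset.sum_const, Finset.card_range, ← Finset.sum_add_distrib, ← mul_smul,
      ← add_smul]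
    refine Finset.sum_congr rfl fun i _ => ?_
    congr 1
    ring
  refine (((of_eq e).trans (of_le (Multiset.le_add_right _ _))).trans h).mono ?_
  simp only [Finset.sum_const, Finset.card_range, Finset.card_univ, smul_eq_mul, zero_add,
    add_zero, mul_one]
  refine Nat.mul_le_mul_left _ ?_
  have : 0 < 2 ^ m := by positivity
  nlinarith [Nat.mul_le_mul_left (2 ^ m * 2 ^ m) this]

/-- Windows of length `ℓ` are combined to windows of length `2 ^ m * ℓ`. The generated carries are
delayed by `m + 1` only, `1` for the masks and `m` for a butterfly, if the propagation tokens are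
available sufficiently early to compute the masks in advance. -/
theorem windowTokens_mul (G P : Γ → (ι → Bool) → Bool) (e : Γ) {m ℓ σ τ : ℕ}
    (hστ : τ + 2 * m + 4 ≤ σ) :
    Derives (Fintype.card Γ * (10 * (2 ^ m * 2 ^ m * 2 ^ m))) (windowTokens G P e m ℓ σ τ)
      (windowTokens G P e m (2 ^ m * ℓ) (σ + m + 1) (τ + m + 1)) := by
  set H : Γ → (ι → Bool) → Bool := fun i a => windowGenerate (G · a) (P · a) e ℓ i with hH
  set W : Γ → (ι → Bool) → Bool := fun i a => windowPropagate (P · a) e ℓ i with hW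
  set c : ℕ → Γ := fun j => j • ℓ • e with hc
  set K : Γ → ℕ → (ι → Bool) → Bool := fun i j a => decide (∀ l < 2 ^ m,
        (if l < j then W (i - c l) a else true) = true) with hK
  -- copies of the propagation tokens, for the longer windows and for the masks
  have split (i : Γ) : Derives (2 ^ m * (1 + 2 ^ (m + 2))) (2 ^ m • {(W i, τ)})
      (2 ^ m • {(W i, τ + 1)} + (2 ^ m * 2 ^ (m + 2)) • {(W i, τ + 1 + (m + 2))}) := by
    rw [mul_smul, ← nsmul_add]
    refine nsmul _ ((buf _ _).trans ?_)
    rw [two_nsmul]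
    exact (dup _ _ _).add_left _
  have longer (i : Γ) : Derives (2 ^ m * 2 ^ m)
      (∑ j ∈ Finset.range (2 ^ m), {(W (i - c j), τ + 1)})
      (2 ^ m • {(fun a => windowPropagate (P · a) e (2 ^ m * ℓ) i, τ + m + 1)}) := by
    have h := butterfly_and m (fun j => W (i - c j)) (τ + 1)
    simp only [windowPropagate_mul]
    rwa [add_right_comm] at h
  have late (i : Γ) (j : ℕ) : Derives 1 ({(H (i - c j), σ)} + {(K i j, τ + 1 + (m + 2) + 1 + m)})
      {(fun a => H (i - c j) a && K i j a, σ + 1)} :=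
    (and _ _ (le_refl σ) (by omega)).trans (nsmul_one one_le_two)
  have generate (i : Γ) : Derives (2 ^ m * 1 + 2 ^ m * 2 ^ m)
      (∑ j ∈ Finset.range (2 ^ m), ({(H (i - c j), σ)} + {(K i j, τ + 1 + (m + 2) + 1 + m)}))
      (2 ^ m • {(fun a => windowGenerate (G · a) (P · a) e (2 ^ m * ℓ) i, σ + m + 1)}) := by
    have h := (sum (Finset.range (2 ^ m)) fun j _ => late i j).trans
      (butterfly_or m (fun j a => H (i - c j) a && K i j a) (σ + 1))
    simp only [windowGenerate_mul]
    rw [Finset.sum_const, Finset.card_range, smul_eq_mul, add_right_comm σ] at h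
    exact h
  have h₁ := (sum Finset.univ fun i _ => split i)
  rw [Finset.sum_add_distrib, sum_nsmul_eq_sum_sum_sub _ (fun i => {(W i, τ + 1)}) c] at h₁
  have h₂ := h₁.trans ((sum Finset.univ fun i _ => longer i).add (masks m W c (τ + 1 + (m + 2))))
  have h₃ := h₂.add_left (∑ i, 2 ^ m • {(H i, σ)})
  rw [sum_nsmul_eq_sum_sum_sub _ (fun i => {(H i, σ)}) c] at h₃
  have h₄ := sum Finset.univ fun i _ => generate i
  simp only [Finset.sum_add_distrib] at h₄
  have h₅ := h₃.trans ((of_eq (by rw [add_left_comm, add_comm])).trans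
    (h₄.add_right (∑ i, 2 ^ m • {(fun a => windowPropagate (P · a) e (2 ^ m * ℓ) i, τ + m + 1)})))
  rw [← sum_nsmul_eq_sum_sum_sub _ (fun i => {(H i, σ)}) c] at h₅
  refine h₅.mono ?_
  simp only [Finset.sum_const, Finset.card_univ, smul_eq_mul, ← mul_add, zero_add]
  refine Nat.mul_le_mul_left _ ?_
  have hr : 1 ≤ 2 ^ m := Nat.one_le_two_pow
  rw [pow_add]
  nlinarith [Nat.mul_le_mul_left (2 ^ m * 2 ^ m) hr, Nat.mul_le_mul_left (2 ^ m) hr]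

theorem windowTokens_pow (G P : Γ → (ι → Bool) → Bool) (e : Γ) {m σ τ : ℕ}
    (hστ : τ + 2 * m + 4 ≤ σ) (k : ℕ) :
    Derives (k * (Fintype.card Γ * (10 * (2 ^ m * 2 ^ m * 2 ^ m)))) (windowTokens G P e m 1 σ τ)
      (windowTokens G P e m ((2 ^ m) ^ k) (σ + k * (m + 1)) (τ + k * (m + 1))) := by
  induction k with
  | zero => simpa using refl _
  | succ k ih =>
    have h := ih.trans (windowTokens_mul G P e (by omega))
    rw [← pow_succ'] at h
    convert h using 1 <;> [ring; skip]
    congr 1 <;> ring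

end Derives

end Windows

/-! ### Carries -/

/-- The carry into position `lo + len` when the carry into position `lo` is `c`; the functions `g`
and `p` tell which positions generate and which positions propagate a carry. -/
def carry (g p : ℕ → Bool) (c : Bool) (lo : ℕ) : ℕ → Bool
  | 0 => c
  | len + 1 => g (lo + len) || (p (lo + len) && carry g p c lo len)

theorem carry_add (g p : ℕ → Bool) (c : Bool) (lo l₁ l₂ : ℕ) :
    carry g p c lo (l₁ + l₂) = carry g p (carry g p c lo l₁) (lo + l₁) l₂ := by
  induction l₂ with
  | zero => rfl
  | succ l₂ ih =>
    change (g (lo + (l₁ + l₂)) || (p (lo + (l₁ + l₂)) && carry g p c lo (l₁ + l₂))) = _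
    rw [ih, ← add_assoc]
    rfl

theorem carry_eq (g p : ℕ → Bool) (c : Bool) (lo len : ℕ) :
    carry g p c lo len =
      (carry g p false lo len || (decide (∀ i < len, p (lo + i) = true) && c)) := by
  induction len with
  | zero => simp [carry]
  | succ len ih =>
    simp only [carry]
    rw [ih]
    simp only [Nat.forall_lt_succ_right, Bool.decide_and, Bool.decide_eq_true]
    generalize decide (∀ i < len, p (lo + i) = true) = q
    cases g (lo + len) <;> cases p (lo + len) <;> cases q <;> cases c <;> simp

/-- The sum of two binary numbers, digit by digit. -/
theorem sum_range_xor_carry (a b : ℕ → Bool) (n : ℕ) :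
    (∑ i ∈ Finset.range n, (Bool.xor (Bool.xor (a i) (b i))
      (carry (fun i => a i && b i) (fun i => Bool.xor (a i) (b i)) false 0 i)).toNat * 2 ^ i) +
      (carry (fun i => a i && b i) (fun i => Bool.xor (a i) (b i)) false 0 n).toNat * 2 ^ n =
    ∑ i ∈ Finset.range n, (a i).toNat * 2 ^ i + ∑ i ∈ Finset.range n, (b i).toNat * 2 ^ i := by
  induction n with
  | zero => simp [carry]
  | succ n ih =>
    simp only [Finset.sum_range_succ, carry, zero_add]
    generalize carry _ _ false 0 n = c at ih ⊢
    have key : (Bool.xor (Bool.xor (a n) (b n)) c).toNat +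
        2 * ((a n && b n) || (Bool.xor (a n) (b n) && c)).toNat =
        (a n).toNat + (b n).toNat + c.toNat := by
      cases a n <;> cases b n <;> cases c <;> rfl
    rw [pow_succ]
    linear_combination ih + 2 ^ n * key

theorem Nat.ofBits_eq_sum {n : ℕ} (f : ℕ → Bool) :
    Nat.ofBits (fun i : Fin n => f i) = ∑ i ∈ Finset.range n, (f i).toNat * 2 ^ i := by
  induction n generalizing f with
  | zero => simp
  | succ n ih =>
    rw [Nat.ofBits_succ, Finset.sum_range_succ']
    have := ih fun i => f (i + 1)
    simp only [Function.comp_def, Fin.val_succ, this, Finset.mul_sum, pow_succ]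
    simp [mul_comm, mul_left_comm]

/-! ### Carry trees -/

section Tree

variable {ι : Type} (g p : ℕ → (ι → Bool) → Bool)

/-- The tokens for a single bit position. -/
def bitTokens (t i : ℕ) : Multiset (Token ι) := 3 • {(p i, t)} + 2 • {(g i, t)}

/-- Whether a block of `len` positions generates a carry. -/
def blockGenerate (lo len : ℕ) (a : ι → Bool) : Bool := carry (g · a) (p · a) false lo len

/-- Whether a block of `len` positions propagates a carry. -/
def blockPropagate (lo len : ℕ) (a : ι → Bool) : Bool := decide (∀ i < len, p (lo + i) a = true)

/-- The digit of the sum at position `lo + i` when the carry into position `lo` is `c`. -/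
def sumBit (c : (ι → Bool) → Bool) (lo i : ℕ) (a : ι → Bool) : Bool :=
  Bool.xor (p (lo + i) a) (carry (g · a) (p · a) (c a) lo i)

open Derives in
/-- A binary tree above a block of positions. In a first pass, from the leaves to the root, it
computes whether the block generates or propagates a carry; the tokens in `Res` are left for a
second pass, in which the carry into the block is turned into the carries into its positions. -/
theorem exists_carryTree (t : ℕ) (h : ℕ) : ∀ lo len, 1 ≤ len → len ≤ 2 ^ h →
    ∃ Res : Multiset (Token ι),
      Derives (3 * len - 3) (∑ i ∈ Finset.range len, bitTokens g p t (lo + i))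
        (2 • {(blockGenerate g p lo len, t + 2 * h)} +
          2 • {(blockPropagate p lo len, t + 2 * h)} + Res) ∧
      ∀ c t', t + 2 * h ≤ t' → Derives (4 * len - 3) (Res + 2 • {(c, t')})
        (∑ i ∈ Finset.range len, {(sumBit g p c lo i, t' + 2 * h + 1)}) := by
  have leaf (h lo : ℕ) : ∃ Res : Multiset (Token ι),
      Derives 0 (bitTokens g p t lo)
        (2 • {(blockGenerate g p lo 1, t + 2 * h)} +
          2 • {(blockPropagate p lo 1, t + 2 * h)} + Res) ∧
      ∀ c t', t + 2 * h ≤ t' → Derives 1 (Res + 2 • {(c, t')})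
        ({(sumBit g p c lo 0, t' + 2 * h + 1)}) := by
    refine ⟨{(p lo, t)}, ?_, fun c t' ht' => ?_⟩
    · have e₁ : blockGenerate g p lo 1 = g lo := by funext a; simp [blockGenerate, carry]
      have e₂ : blockPropagate p lo 1 = p lo := by funext a; simp [blockPropagate]
      have e₃ : bitTokens g p t lo = 2 • {(g lo, t)} + 2 • {(p lo, t)} + {(p lo, t)} := by
        rw [bitTokens]
        abel
      rw [e₁, e₂, e₃]
      exact (((delay (g lo) (Nat.le_add_right t (2 * h))).nsmul 2).add
        ((delay (p lo) (Nat.le_add_right t (2 * h))).nsmul 2)).add_right _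
    · have h₁ := ((nsmul_one one_le_two).add_left {(p lo, t)}).trans
        ((xor (p lo) c (by omega) (le_refl t')).trans ((nsmul_one one_le_two).trans
          (delay _ (by omega : t' + 1 ≤ t' + 2 * h + 1))))
      have e : sumBit g p c lo 0 = fun a => Bool.xor (p lo a) (c a) := by
        funext a; simp [sumBit, carry]
      rw [e]
      simpa using h₁
  induction h with
  | zero =>
    intro lo len h₁ h₂
    obtain rfl : len = 1 := by simp at h₂; omega
    simpa using leaf 0 lo
  | succ h ih =>
    intro lo len h₁ h₂
    obtain rfl | hlen : len = 1 ∨ 2 ≤ len := by omega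
    · simpa using leaf (h + 1) lo
    obtain ⟨l₁, l₂, rfl, hl₁, hl₁', hl₂, hl₂'⟩ :
        ∃ l₁ l₂, len = l₁ + l₂ ∧ 1 ≤ l₁ ∧ l₁ ≤ 2 ^ h ∧ 1 ≤ l₂ ∧ l₂ ≤ 2 ^ h := by
      rw [pow_succ] at h₂
      exact ⟨len / 2, len - len / 2, by omega, by omega, by omega, by omega, by omega⟩
    obtain ⟨R₁, up₁, down₁⟩ := ih lo l₁ hl₁ hl₁'
    obtain ⟨R₂, up₂, down₂⟩ := ih (lo + l₁) l₂ hl₂ hl₂'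
    set T := t + 2 * h with hT
    refine ⟨R₁ + R₂ + {(blockPropagate p lo l₁, T)} + {(blockGenerate g p lo l₁, T)},
      ?_, fun c t' ht' => ?_⟩
    · have eG : (fun a => blockGenerate g p (lo + l₁) l₂ a ||
          (blockPropagate p (lo + l₁) l₂ a && blockGenerate g p lo l₁ a)) =
          blockGenerate g p lo (l₁ + l₂) := by
        funext a
        simp only [blockGenerate, blockPropagate]
        rw [carry_add, carry_eq _ _ (carry _ _ _ lo l₁)]
      have eP : (fun a => blockPropagate p lo l₁ a && blockPropagate p (lo + l₁) l₂ a) =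
          blockPropagate p lo (l₁ + l₂) := by
        funext a
        rw [Bool.eq_iff_iff]
        simp only [blockPropagate, Bool.and_eq_true, decide_eq_true_eq]
        constructor
        · rintro ⟨h₁, h₂⟩ i hi
          by_cases hil : i < l₁
          · exact h₁ i hil
          · have := h₂ (i - l₁) (by omega)
            rwa [add_assoc, Nat.add_sub_cancel' (by omega)] at this
        · exact fun h => ⟨fun i hi => h i (by omega),
            fun i hi => by rw [add_assoc]; exact h _ (by omega)⟩
      have up := up₁.add up₂
      simp only [add_assoc lo] at up
      rw [← Finset.sum_range_add fun i => bitTokens g p t (lo + i)] at up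
      have hG := ((and (blockPropagate p (lo + l₁) l₂) (blockGenerate g p lo l₁)
        (le_refl T) (le_refl T)).trans (nsmul_one one_le_two)).add_left
          {(blockGenerate g p (lo + l₁) l₂, T)} |>.trans
        (or _ _ (Nat.le_succ T) (le_refl (T + 1)))
      have hP := (and (blockPropagate p lo l₁) (blockPropagate p (lo + l₁) l₂)
        (le_refl T) (le_refl T)).trans ((delay _ (Nat.le_succ (T + 1))).nsmul 2)
      rw [eG] at hG
      rw [eP] at hP
      have hGP := (hG.add hP).add_right
        (R₁ + R₂ + {(blockPropagate p lo l₁, T)} + {(blockGenerate g p lo l₁, T)})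
      refine (up.trans ((of_le ?_).trans hGP)).mono (by omega)
      refine Multiset.le_iff_exists_add.2 ⟨{(blockGenerate g p (lo + l₁) l₂, T)}, ?_⟩
      simp only [two_nsmul]
      abel
    · have eC : (fun a => blockGenerate g p lo l₁ a || (blockPropagate p lo l₁ a && c a)) =
          fun a => carry (g · a) (p · a) (c a) lo l₁ := by
        funext a
        simp only [blockGenerate, blockPropagate]
        rw [carry_eq _ _ (c a)]
      have hC := ((and (blockPropagate p lo l₁) c (by omega : T ≤ t') (le_refl t')).trans
        (nsmul_one one_le_two)).add_left {(blockGenerate g p lo l₁, T)} |>.trans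
        (or _ _ (by omega : T ≤ t' + 1) (le_refl (t' + 1)))
      rw [eC] at hC
      have hc := (buf c t').trans ((delay c (Nat.le_succ (t' + 1))).nsmul 2)
      have hd₁ := down₁ c (t' + 2) (by omega)
      have hd₂ := down₂ (fun a => carry (g · a) (p · a) (c a) lo l₁) (t' + 2) (by omega)
      have hR := ((hc.add_left R₁).trans hd₁).add ((hC.add_left R₂).trans hd₂)
      have e : ∀ i, sumBit g p (fun a => carry (g · a) (p · a) (c a) lo l₁) (lo + l₁) i =
          sumBit g p c lo (l₁ + i) := by
        intro i
        funext a
        simp only [sumBit]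
        rw [carry_add, add_assoc]
      simp only [e] at hR
      rw [← Finset.sum_range_add fun i =>
        ({(sumBit g p c lo i, t' + 2 + 2 * h + 1)} : Multiset (Token ι))] at hR
      have e' : t' + 2 + 2 * h + 1 = t' + 2 * (h + 1) + 1 := by ring
      rw [e'] at hR
      refine ((Derives.of_eq ?_).trans hR).mono (by omega)
      rw [two_nsmul]
      abel

end Tree

/-! ### Carries into blocks -/

theorem windowGenerate_succ {Γ : Type} [AddCommGroup Γ] (G P : Γ → Bool) (e : Γ) (ℓ : ℕ) (i : Γ) :
    windowGenerate G P e (ℓ + 1) i = (G i || (P i && windowGenerate G P e ℓ (i - e))) := by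
  rw [Bool.eq_iff_iff]
  have hsub : ∀ v : ℕ, i - e - v • e = i - (v + 1) • e := fun v => by rw [succ_nsmul']; abel
  simp only [windowGenerate, Bool.or_eq_true, Bool.and_eq_true, decide_eq_true_eq, hsub]
  constructor
  · rintro ⟨_ | u, hu, hG, hP⟩
    · exact .inl (by simpa using hG)
    · refine .inr ⟨by simpa using hP 0 (by omega), u, by omega, hG, fun v hv => hP _ (by omega)⟩
  · rintro (hG | ⟨h0, u, hu, hG, hP⟩)
    · exact ⟨0, by omega, by simpa using hG, by simp⟩
    · refine ⟨u + 1, by omega, hG, ?_⟩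
      rintro (_ | v) hv
      · simpa using h0
      · exact hP v (by omega)

theorem windowGenerate_one {Γ : Type} [AddCommGroup Γ] (G P : Γ → Bool) (e : Γ) (i : Γ) :
    windowGenerate G P e 1 i = G i := by
  simp [windowGenerate]

theorem windowPropagate_one {Γ : Type} [AddCommGroup Γ] (P : Γ → Bool) (e : Γ) (i : Γ) :
    windowPropagate P e 1 i = P i := by
  simp [windowPropagate]

/-- The number of those positions `i < n` for which `i / L = b`. -/
def blockLength (n L b : ℕ) : ℕ := min L (n - b * L)

theorem sum_range_blocks {M : Type*} [AddCommMonoid M] (f : ℕ → M) (n L N : ℕ) :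
    ∑ i ∈ Finset.range (min n (N * L)), f i =
      ∑ b ∈ Finset.range N, ∑ i ∈ Finset.range (blockLength n L b), f (b * L + i) := by
  induction N with
  | zero => simp
  | succ N ih =>
    rw [Finset.sum_range_succ, ← ih]
    have : min n ((N + 1) * L) = min n (N * L) + blockLength n L N := by
      rw [blockLength, add_mul, one_mul]
      omega
    rw [this, Finset.sum_range_add]
    congr 1
    refine Finset.sum_congr rfl fun i hi => ?_
    rw [Finset.mem_range, blockLength] at hi
    rw [min_eq_right (by omega)]

section Blocks

variable {n L M : ℕ}

theorem sum_fin_blocks {M' : Type*} [AddCommMonoid M'] (f : ℕ → M') (h : n ≤ (M + 1) * L) :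
    ∑ b : Fin (M + 1), ∑ i ∈ Finset.range (blockLength n L b), f (b * L + i) =
      ∑ i ∈ Finset.range n, f i := by
  rw [Fin.sum_univ_eq_sum_range
    (fun b => ∑ i ∈ Finset.range (blockLength n L b), f (b * L + i)), ← sum_range_blocks,
    min_eq_left h]

/-- In the cyclic arrangement of the blocks, a window that ends in block `i` and reaches down to
block `0` generates a carry if and only if there is a carry out of block `i`. It may even wrap
around, as block `0` is declared not to propagate carries. -/
theorem windowGenerate_blocks (g p : ℕ → Bool) (hM : M * L < n) {ℓ : ℕ} (b : ℕ)
    (i : Fin (M + 1)) (hi : i.val = b) (hb : b < ℓ) :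
    windowGenerate
      (fun i : Fin (M + 1) => carry g p false (i * L) (blockLength n L i))
      (fun i => if i = 0 then false else
        decide (∀ j < blockLength n L i, p (i * L + j) = true)) 1 ℓ i =
      carry g p false 0 (b * L + blockLength n L b) := by
  induction b generalizing i ℓ with
  | zero =>
    obtain ⟨ℓ, rfl⟩ : ∃ l, ℓ = l + 1 := ⟨ℓ - 1, by omega⟩
    obtain rfl : i = 0 := Fin.ext hi
    simp [windowGenerate_succ]
  | succ b ih =>
    obtain ⟨ℓ, rfl⟩ : ∃ l, ℓ = l + 1 := ⟨ℓ - 1, by omega⟩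
    have h0 : i ≠ 0 := by rintro rfl; simp at hi
    have hlen : blockLength n L b = L := by
      have h₁ : (b + 1) * L ≤ M * L := Nat.mul_le_mul_right _ (by omega)
      rw [blockLength]
      rw [add_mul] at h₁
      omega
    rw [windowGenerate_succ, ih (i - 1) (by rw [Fin.val_sub_one_of_ne_zero h0]; omega) (by omega),
      if_neg h0, hi, hlen, carry_add g p false 0 ((b + 1) * L), add_mul b, one_mul, zero_add,
      ← carry_eq]

variable {ι : Type} (g p : ℕ → (ι → Bool) → Bool)

open Derives in
/-- All digits of the sum. The carries out of the blocks of `2 ^ h` positions are computed in `k`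
rounds, each of which extends the windows of blocks under consideration by a factor of `2 ^ m`. -/
theorem derives_sumBits {h m k : ℕ} (t : ℕ) (hM : M * 2 ^ h < n) (hn : n ≤ (M + 1) * 2 ^ h)
    (hm : 1 ≤ m) (hk : M + 1 ≤ (2 ^ m) ^ k) :
    Derives (7 * n + (M + 1) * ((10 * k + 4) * (2 ^ m * 2 ^ m * 2 ^ m)))
      (∑ i ∈ Finset.range n, bitTokens g p t i)
      (∑ i ∈ Finset.range n,
        {(sumBit g p (fun _ => false) 0 i, t + k * (m + 1) + 4 * h + 3 * m + 6)} +
        {(blockGenerate g p 0 n, t + k * (m + 1) + 4 * h + 3 * m + 6)}) := by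
  set len : Fin (M + 1) → ℕ := fun b => blockLength n (2 ^ h) b with hlen
  set T := t + 2 * h with hT
  set σ := T + 3 * m + 5 with hσ
  set σ' := σ + k * (m + 1) with hσ'
  set G : Fin (M + 1) → (ι → Bool) → Bool := fun b => blockGenerate g p (b * 2 ^ h) (len b) with hG
  set P : Fin (M + 1) → (ι → Bool) → Bool := fun b => blockPropagate p (b * 2 ^ h) (len b) with hP
  set P' : Fin (M + 1) → (ι → Bool) → Bool := fun b a => if b = 0 then false else P b a with hP'
  set H : Fin (M + 1) → (ι → Bool) → Bool :=
    fun b a => windowGenerate (G · a) (P' · a) 1 ((2 ^ m) ^ k) b with hH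
  set cin : Fin (M + 1) → (ι → Bool) → Bool := fun b => blockGenerate g p 0 (b * 2 ^ h) with hcin
  have hlen_sum : ∑ b, len b = n := by
    simpa only [Finset.sum_const, Finset.card_range, smul_eq_mul, mul_one] using
      sum_fin_blocks (fun _ => (1 : ℕ)) hn
  have hH_eq (b : Fin (M + 1)) : H b = blockGenerate g p 0 (b * 2 ^ h + len b) := by
    funext a
    exact windowGenerate_blocks (g · a) (p · a) hM b b rfl (b.2.trans_le hk)
  have hcin_zero : cin 0 = fun _ => false := by
    funext a
    simp [hcin, blockGenerate, carry]
  have hcin_pos (b : Fin (M + 1)) (hb : b ≠ 0) : H (b - 1) = cin b := by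
    have hb' : b.val ≠ 0 := fun h => hb (Fin.ext h)
    have h₁ : (b : ℕ) * 2 ^ h ≤ M * 2 ^ h := Nat.mul_le_mul_right _ (by omega)
    have h₂ : ((b : ℕ) - 1) * 2 ^ h + 2 ^ h = b * 2 ^ h := by
      rw [← Nat.succ_mul, Nat.succ_eq_add_one, Nat.sub_add_cancel (by omega)]
    have h₃ : ((b - 1 : Fin (M + 1)) : ℕ) = b - 1 := Fin.val_sub_one_of_ne_zero hb
    rw [hH_eq]
    simp only [hcin, hlen, h₃]
    rw [show blockLength n (2 ^ h) (b - 1) = 2 ^ h by rw [blockLength]; omega, h₂]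
  have hcout : H (0 - 1) = blockGenerate g p 0 n := by
    have h₃ : ((0 - 1 : Fin (M + 1)) : ℕ) = M := by
      rw [zero_sub]
      exact Fin.coe_neg_one
    rw [hH_eq]
    simp only [hlen, h₃]
    have h₁ := add_mul M 1 (2 ^ h)
    rw [blockLength, min_eq_right (by omega), Nat.add_sub_cancel' hM.le]
  -- both passes through the trees of the blocks
  have tree (b : Fin (M + 1)) := exists_carryTree g p t h (b * 2 ^ h) (len b)
    (by
      have h₁ : (b : ℕ) * 2 ^ h ≤ M * 2 ^ h := Nat.mul_le_mul_right _ (by omega)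
      have : 0 < 2 ^ h := by positivity
      simp only [hlen, blockLength]
      omega)
    (min_le_left _ _)
  choose Res up down using tree
  have hup := (Derives.of_eq (sum_fin_blocks (bitTokens g p t) hn).symm).trans
    (sum Finset.univ fun b _ => up b)
  simp only [Finset.sum_add_distrib] at hup
  have hdown := sum Finset.univ fun b _ => down b (cin b) σ' (by omega)
  simp only [Finset.sum_add_distrib] at hdown
  have e_sum : ∑ b, ∑ i ∈ Finset.range (len b),
      ({(sumBit g p (cin b) (b * 2 ^ h) i, σ' + 2 * h + 1)} : Multiset (Token ι)) =
      ∑ i ∈ Finset.range n, {(sumBit g p (fun _ => false) 0 i, σ' + 2 * h + 1)} := by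
    rw [← sum_fin_blocks _ hn]
    refine Finset.sum_congr rfl fun b _ => Finset.sum_congr rfl fun i _ => ?_
    congr 2
    funext a
    simp only [sumBit, zero_add, hcin, blockGenerate]
    rw [carry_add, zero_add]
  rw [e_sum] at hdown
  -- copies of the tokens of the blocks, and a constant for the carry into block `0`
  have hGcopy (b : Fin (M + 1)) : Derives (2 ^ m) (2 • {(G b, T)})
      (2 ^ m • {(fun a => windowGenerate (G · a) (P' · a) 1 1 b, σ)}) := by
    simp only [windowGenerate_one]
    have := (nsmul_one one_le_two).trans ((dup (G b) T m).trans
      ((delay _ (by omega : T + m ≤ σ)).nsmul (2 ^ m)))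
    simpa using this
  have hPcopy (b : Fin (M + 1)) : Derives (2 ^ m + 2) (2 • {(P b, T)})
      (2 ^ m • {(fun a => windowPropagate (P' · a) 1 1 b, T + 1 + m)} +
        if b = 0 then 2 • {(fun _ => false, T + 2)} else 0) := by
    simp only [windowPropagate_one]
    by_cases hb : b = 0
    · have h₁ := (Derives.of_eq (two_nsmul _)).trans (xor (P b) (P b) (le_refl T) (le_refl T))
      simp only [Bool.xor_self, two_nsmul] at h₁
      have h₂ := h₁.trans ((dup (fun _ => false) (T + 1) m).add (buf (fun _ => false) (T + 1)))
      simp only [hP', hb, if_true]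
      rw [← two_nsmul, hb] at h₂
      exact h₂.mono (by omega)
    · have h₁ := (nsmul_one one_le_two).trans ((dup (P b) T m).trans
        ((delay _ (by omega : T + m ≤ T + 1 + m)).nsmul (2 ^ m)))
      simp only [hP', hb, if_false, add_zero]
      exact h₁.mono (by omega)
  have hcopy := (sum Finset.univ fun b _ => hGcopy b).add (sum Finset.univ fun b _ => hPcopy b)
  simp only [Finset.sum_add_distrib, Finset.sum_ite_eq', Finset.mem_univ, if_true] at hcopy
  have hwin := (windowTokens_pow G P' 1 (by omega : T + 1 + m + 2 * m + 4 ≤ σ) k).trans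
    (of_le (Multiset.le_add_right _ _))
  -- the carry out of block `b - 1` is the carry into block `b`
  have hcarry (b : Fin (M + 1)) : Derives 0
      (2 • {(H (b - 1), σ')} + if b = 0 then 2 • {(fun _ => false, T + 2)} else 0)
      (2 • {(cin b, σ')} + if b = 0 then {(blockGenerate g p 0 n, σ')} else 0) := by
    by_cases hb : b = 0
    · subst hb
      simp only [if_true]
      rw [hcout, hcin_zero]
      have h₁ := ((delay (fun _ => false) (by omega : T + 2 ≤ σ')).nsmul 2).add
        (nsmul_one (x := (blockGenerate g p 0 n, σ')) one_le_two)
      exact (Derives.of_eq (add_comm _ _)).trans h₁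
    · rw [if_neg hb, if_neg hb, hcin_pos b hb]
      exact refl _
  have hcarries := sum Finset.univ fun b _ => hcarry b
  simp only [Finset.sum_add_distrib, Finset.sum_ite_eq', Finset.mem_univ, if_true] at hcarries
  have e_shift : ∑ b, 2 • {(H (b - 1), σ')} = ∑ b, 2 • ({(H b, σ')} : Multiset (Token ι)) :=
    Equiv.sum_comp (Equiv.subRight 1) fun b => 2 • ({(H b, σ')} : Multiset (Token ι))
  rw [e_shift] at hcarries
  have htwo : Derives 0 (∑ b, 2 ^ m • {(H b, σ')}) (∑ b, 2 • {(H b, σ')}) := by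
    have h₁ (b : Fin (M + 1)) : Derives 0 (2 ^ m • {(H b, σ')}) (2 • {(H b, σ')}) :=
      of_le (nsmul_le_nsmul_left zero_le (Nat.le_self_pow (by omega) 2))
    simpa using sum Finset.univ fun b _ => h₁ b
  have htop := hcopy.trans ((Derives.of_eq (add_assoc _ _ _).symm).trans
    (((hwin.trans htwo).add_right _).trans hcarries))
  have hall := hup.trans ((htop.add_right _).trans ((Derives.of_eq
    (by rw [add_right_comm, add_comm (∑ b, 2 • {(cin b, σ')})])).trans
      (hdown.add (delay (blockGenerate g p 0 n) (by omega : σ' ≤ σ' + 2 * h + 1)))))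
  have e_time : σ' + 2 * h + 1 = t + k * (m + 1) + 4 * h + 3 * m + 6 := by omega
  rw [e_time] at hall
  refine hall.mono ?_
  have c₁ : ∑ b, (3 * len b - 3) ≤ 3 * n := by
    rw [← hlen_sum, Finset.mul_sum]
    exact Finset.sum_le_sum fun _ _ => Nat.sub_le _ _
  have c₂ : ∑ b, (4 * len b - 3) ≤ 4 * n := by
    rw [← hlen_sum, Finset.mul_sum]
    exact Finset.sum_le_sum fun _ _ => Nat.sub_le _ _
  have c₃ : 2 ^ m + (2 ^ m + 2) ≤ 4 * (2 ^ m * 2 ^ m * 2 ^ m) := by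
    have hr : 1 ≤ 2 ^ m := Nat.one_le_two_pow
    nlinarith [Nat.mul_le_mul_left (2 ^ m * 2 ^ m) hr, Nat.mul_le_mul_left (2 ^ m) hr]
  have c₄ := Nat.mul_le_mul_left (M + 1) c₃
  simp only [Finset.sum_const, Finset.card_univ, Fintype.card_fin, smul_eq_mul]
  generalize 2 ^ m * 2 ^ m * 2 ^ m = q at c₄ ⊢
  nlinarith

end Blocks

/-! ### Circuit graphs and their valuations -/

namespace CircuitGraph

variable {ι ο : Type} (c : CircuitGraph ι ο)

/-- Values of the inputs and gates, as functions of the inputs, that are compatible with the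
gates. -/
def IsValuation (V : ι ⊕ c.Gate → (ι → Bool) → Bool) : Prop :=
  (∀ i x, V (.inl i) x = x i) ∧
    ∀ g x, V (.inr g) x = (c.kind g).eval fun i => V (c.operand g i) x

/-- There is a directed path from the input `i` to the vertex `v`. -/
def Reaches (i : ι) (v : c.Vertex) : Prop := Relation.ReflTransGen c.Adj (.inl (.inl i)) v

variable {c}

theorem adj_operand (g : c.Gate) (i : Fin (c.kind g).arity) :
    c.Adj (.inl (c.operand g i)) (.inl (.inr g)) :=
  ⟨.inl ⟨g, i⟩, rfl, rfl⟩

theorem adj_outputSource (o : ο) : c.Adj (.inl (c.outputSource o)) (.inr o) :=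
  ⟨.inr o, rfl, rfl⟩

theorem not_adj_input (v : c.Vertex) (i : ι) : ¬ c.Adj v (.inl (.inl i)) := by
  rintro ⟨w | w, -, h⟩ <;> simp [wireTarget] at h

theorem exists_of_adj_gate {v : c.Vertex} {g : c.Gate} (h : c.Adj v (.inl (.inr g))) :
    ∃ i, v = .inl (c.operand g i) := by
  obtain ⟨⟨g', i⟩ | w, h₁, h₂⟩ := h
  · simp only [wireTarget, Sum.inl.injEq, Sum.inr.injEq] at h₂
    subst h₂
    exact ⟨i, h₁.symm⟩
  · simp [wireTarget] at h₂

theorem exists_of_adj_output {v : c.Vertex} {o : ο} (h : c.Adj v (.inr o)) :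
    v = .inl (c.outputSource o) := by
  obtain ⟨w | w, h₁, h₂⟩ := h
  · simp [wireTarget] at h₂
  · simp only [wireTarget, Sum.inr.injEq] at h₂
    subst h₂
    exact h₁.symm

theorem not_adj_of_output {v : c.Vertex} {o : ο} : ¬ c.Adj (.inr o) v := by
  rintro ⟨w | w, h, -⟩ <;> simp [wireSource] at h

theorem IsValuation.unique {V V' : ι ⊕ c.Gate → (ι → Bool) → Bool} (hc : c.Acyclic)
    (hV : c.IsValuation V) (hV' : c.IsValuation V') (u : ι ⊕ c.Gate) (x : ι → Bool) :
    V u x = V' u x := by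
  rcases u with i | g
  · rw [hV.1, hV'.1]
  · induction g using hc.wellFounded_feeds.induction with
    | _ g ih =>
      rw [hV.2, hV'.2]
      congr 1
      funext k
      rcases h : c.operand g k with i | g'
      · rw [hV.1, hV'.1]
      · exact ih g' ⟨k, h⟩

/-- The value of a node depends only on the inputs from which there is a path to the node. -/
theorem IsValuation.congr {V : ι ⊕ c.Gate → (ι → Bool) → Bool} (hc : c.Acyclic)
    (hV : c.IsValuation V) {x x' : ι → Bool} (u : ι ⊕ c.Gate)
    (h : ∀ i, c.Reaches i (.inl u) → x i = x' i) : V u x = V u x' := by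
  rcases u with i | g
  · rw [hV.1, hV.1]
    exact h i .refl
  · induction g using hc.wellFounded_feeds.induction with
    | _ g ih =>
      rw [hV.2, hV.2]
      congr 1
      funext k
      rcases hk : c.operand g k with i | g'
      · rw [hV.1, hV.1]
        exact h i (.single (hk ▸ adj_operand g k))
      · exact ih g' ⟨k, hk⟩ fun i hi => h i (hi.tail (hk ▸ adj_operand g k))

/-- An input on which the value of an output depends is connected to this output. -/
theorem IsValuation.reaches {V : ι ⊕ c.Gate → (ι → Bool) → Bool} (hc : c.Acyclic)
    (hV : c.IsValuation V) {x x' : ι → Bool} {i : ι} {o : ο} (hx : ∀ j, j ≠ i → x j = x' j)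
    (ho : V (c.outputSource o) x ≠ V (c.outputSource o) x') :
    c.Reaches i (.inl (c.outputSource o)) := by
  by_contra h
  refine ho (hV.congr hc _ fun j hj => hx j ?_)
  rintro rfl
  exact h hj

theorem _root_.GateKind.arity_pos (k : GateKind) : 0 < k.arity := by
  cases k <;> simp [GateKind.arity]

theorem _root_.GateKind.arity_le_two (k : GateKind) : k.arity ≤ 2 := by
  cases k <;> simp [GateKind.arity]

theorem fanIn_le_two : c.fanIn ≤ 2 := by
  refine iSup_le fun v => ?_
  rcases v with (i | g) | o
  · have : {w : c.Wire | c.wireTarget w = .inl (.inl i)} = ∅ :=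
      Set.eq_empty_of_forall_notMem fun w hw => not_adj_input _ i ⟨w, rfl, hw⟩
    simp [this]
  · have : {w : c.Wire | c.wireTarget w = .inl (.inr g)} ⊆
        (fun i : Fin (c.kind g).arity => Sum.inl ⟨g, i⟩) '' Set.univ := by
      rintro (⟨g', i⟩ | w) hw
      · simp only [wireTarget, Set.mem_ofPred_eq, Sum.inl.injEq, Sum.inr.injEq] at hw
        subst hw
        exact ⟨i, trivial, rfl⟩
      · simp [wireTarget] at hw
    refine (Set.encard_le_encard this).trans ((Set.encard_image_le _ _).trans ?_)
    rw [Set.encard_univ, ENat.card_eq_coe_fintype_card, Fintype.card_fin]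
    exact_mod_cast (c.kind g).arity_le_two
  · have : {w : c.Wire | c.wireTarget w = .inr o} ⊆ {.inr o} := by
      rintro (w | w) hw
      · simp [wireTarget] at hw
      · simpa [wireTarget] using hw
    refine (Set.encard_le_encard this).trans ?_
    rw [Set.encard_singleton]
    exact one_le_two

/-! ### Depth -/

theorem depth_le_of_rank {ρ : c.Vertex → ℕ} {D : ℕ} (h : ∀ u v, c.Adj u v → ρ u < ρ v)
    (hD : ∀ v, ρ v ≤ D) : c.depth ≤ D := by
  refine iSup_le fun p => ?_
  have key : ∀ i (hi : i < p.length + 1), i ≤ ρ (p.toFun ⟨i, hi⟩) := by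
    intro i
    induction i with
    | zero => simp
    | succ i ih =>
      intro hi
      have h₁ := ih (by omega)
      have h₂ := h _ _ (p.step ⟨i, by omega⟩)
      simp only [Fin.castSucc_mk, Fin.succ_mk] at h₂
      omega
  exact_mod_cast (key p.length (by omega)).trans (hD _)

/-- In an acyclic graph, a directed path visits every vertex at most once. -/
theorem depth_le_card (hc : c.Acyclic) [Finite c.Vertex] : c.depth ≤ Nat.card c.Vertex := by
  refine iSup_le fun p => ?_
  have key : ∀ i j : Fin (p.length + 1), i < j → Relation.TransGen c.Adj (p i) (p j) := by
    let q : RelSeries {e : c.Vertex × c.Vertex | Relation.TransGen c.Adj e.1 e.2} :=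
      ⟨p.length, p.toFun, fun i => .single (p.step i)⟩
    have : SetRel.IsTrans {e : c.Vertex × c.Vertex | Relation.TransGen c.Adj e.1 e.2} :=
      ⟨fun _ _ _ h₁ h₂ => Relation.TransGen.trans h₁ h₂⟩
    exact fun i j hij => q.rel_of_lt hij
  have inj : Function.Injective p.toFun := by
    intro i j hij
    by_contra hne
    rcases lt_or_gt_of_ne hne with h | h
    · exact hc (p j) ((congrArg (Relation.TransGen c.Adj · (p j)) hij).mp (key i j h))
    · exact hc (p i) ((congrArg (Relation.TransGen c.Adj · (p i)) hij).mpr (key j i h))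
  have := Nat.card_le_card_of_injective _ inj
  rw [Nat.card_eq_fintype_card, Fintype.card_fin] at this
  exact_mod_cast (Nat.le_succ _).trans this

theorem ncard_reaches_input_le_one (i : ι) :
    {j | c.Reaches j (.inl (.inl i))}.ncard ≤ 1 := by
  have : {j | c.Reaches j (.inl (.inl i))} ⊆ {i} := by
    intro j hj
    rcases Relation.ReflTransGen.cases_tail hj with h | ⟨v, -, h⟩
    · simpa using h.symm
    · exact absurd h (not_adj_input v i)
  have := Set.ncard_le_ncard this
  rwa [Set.ncard_singleton] at this

/-- As all gates have at most two operands, a node that is reached from more than `2 ^ t` inputs is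
the end of a path of length `t + 1`. -/
theorem exists_path_of_lt_ncard [Finite ι] (t : ℕ) (u : ι ⊕ c.Gate)
    (h : 2 ^ t < {i | c.Reaches i (.inl u)}.ncard) :
    ∃ p : RelSeries {e : c.Vertex × c.Vertex | c.Adj e.1 e.2},
      p.last = .inl u ∧ p.length = t + 1 := by
  induction t generalizing u with
  | zero =>
    rcases u with i | g
    · exact absurd h (by have := ncard_reaches_input_le_one (c := c) i; omega)
    · let p : RelSeries {e : c.Vertex × c.Vertex | c.Adj e.1 e.2} :=
        .singleton _ (.inl (c.operand g ⟨0, (c.kind g).arity_pos⟩))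
      exact ⟨p.snoc (.inl (.inr g)) (adj_operand g _), RelSeries.last_snoc _ _ _, rfl⟩
  | succ t ih =>
    rcases u with i | g
    · have := ncard_reaches_input_le_one (c := c) i
      have := Nat.one_le_two_pow (n := t + 1)
      omega
    · obtain ⟨k, hk⟩ : ∃ k, 2 ^ t < {i | c.Reaches i (.inl (c.operand g k))}.ncard := by
        by_contra! hle
        have hsub : {i | c.Reaches i (.inl (.inr g))} ⊆
            ⋃ k, {i | c.Reaches i (.inl (c.operand g k))} := by
          intro j hj
          rcases Relation.ReflTransGen.cases_tail hj with h | ⟨v, hv, h⟩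
          · simp at h
          · obtain ⟨k, rfl⟩ := exists_of_adj_gate h
            exact Set.mem_iUnion.2 ⟨k, hv⟩
        have h₁ := Set.ncard_le_ncard hsub
        have h₂ : (⋃ k, {i | c.Reaches i (.inl (c.operand g k))}).ncard ≤
            ∑ k, {i | c.Reaches i (.inl (c.operand g k))}.ncard := Set.ncard_iUnion_le_of_fintype _
        have h₃ := Finset.sum_le_card_nsmul Finset.univ _ _ fun k _ => hle k
        rw [Finset.card_univ, Fintype.card_fin, smul_eq_mul] at h₃
        have h₄ := Nat.mul_le_mul_right (2 ^ t) (c.kind g).arity_le_two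
        rw [pow_succ] at h
        omega
      obtain ⟨p, hp, hlen⟩ := ih _ hk
      exact ⟨p.snoc (.inl (.inr g)) (by rw [hp]; exact adj_operand g k), by simp, by simp [hlen]⟩

end CircuitGraph

namespace LogicCircuit

variable {ι ο : Type} (c : LogicCircuit ι ο)

theorem isValuation_gateValue :
    c.IsValuation fun u x => Sum.elim x (c.gateValue x) u :=
  ⟨fun _ _ => rfl, fun g x => c.gateValue_eq x g⟩

end LogicCircuit

/-! ### From partial circuits to logic circuits -/

/-- A realizable family of tokens, one for each output, yields a circuit graph. It may contain gates
from which no output is reached. -/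
theorem Realizable.exists_circuitGraph {ι : Type} {s N D : ℕ} {y : Fin N → (ι → Bool) → Bool}
    (h : Realizable s (∑ o, {(y o, D)})) :
    ∃ (c : CircuitGraph ι (Fin N)) (V : ι ⊕ c.Gate → (ι → Bool) → Bool)
      (rank : ι ⊕ c.Gate → ℕ), c.size ≤ s ∧ c.IsValuation V ∧ (∀ o, V (c.outputSource o) = y o) ∧
      (∀ g i, rank (c.operand g i) < rank (.inr g)) ∧ (∀ o, rank (c.outputSource o) ≤ D) ∧
      c.fanOut ≤ 2 := by
  classical
  obtain ⟨Gate, i, kind, operand, V, rank, free, h1, h2, h3, h4, h5, h6, h7⟩ := h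
  obtain ⟨u, free', rfl, hu, -⟩ :=
    Multiset.exists_of_map_eq_sum_add _ (fun i => (y i, D)) free 0 (by rw [← h7, add_zero])
  simp only [Prod.mk.injEq] at hu
  refine ⟨⟨Gate, inferInstance, kind, operand, fun o => (u o).1⟩, V, rank, ?_, ⟨h2, h3⟩,
    fun o => (hu o).1, h4, fun o => ?_, iSup_le ?_⟩
  · rw [CircuitGraph.size, Nat.card_eq_fintype_card]
    exact h1
  · rw [← (hu o).2]
    exact h5 (u o) (Multiset.mem_add.2 (.inl (Multiset.mem_sum.2 ⟨o, by simp⟩)))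
  · rintro (v | o)
    · have e : ({w | CircuitGraph.wireSource
          ⟨Gate, inferInstance, kind, operand, fun o => (u o).1⟩ w = .inl v} :
          Set ((Σ g : Gate, Fin (kind g).arity) ⊕ Fin N)) =
          ↑(Finset.univ.filter fun w : (Σ g : Gate, Fin (kind g).arity) ⊕ Fin N =>
            v = w.elim (fun q => operand q.1 q.2) fun o => (u o).1) := by
        ext (w | w) <;> simp [CircuitGraph.wireSource, eq_comm]
      have h₁ : (∑ i, ({u i} : Multiset ((ι ⊕ Gate) × ℕ))).map Prod.fst = ∑ i, {(u i).1} := by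
        rw [← Multiset.coe_mapAddMonoidHom, map_sum]
        simp
      have h₂ := h6 inferInstance v
      rw [Multiset.map_add, h₁, ← add_assoc, Multiset.count_add, Multiset.count_add,
        Multiset.count_sum', Multiset.count_sum'] at h₂
      simp only [Multiset.count_sum', Multiset.count_singleton] at h₂
      change Set.encard ({w | CircuitGraph.wireSource
          ⟨Gate, inferInstance, kind, operand, fun o => (u o).1⟩ w = .inl v} :
          Set ((Σ g : Gate, Fin (kind g).arity) ⊕ Fin N)) ≤ 2
      rw [e, Set.encard_coe_eq_coe_finsetCard, Finset.card_filter, Fintype.sum_sum_type,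
        Fintype.sum_sigma]
      simp only [Sum.elim_inl, Sum.elim_inr]
      exact_mod_cast (Nat.le_add_right _ _).trans h₂
    · have : {w | CircuitGraph.wireSource
          ⟨Gate, inferInstance, kind, operand, fun o => (u o).1⟩ w = .inr o} = ∅ :=
        Set.eq_empty_of_forall_notMem fun w hw => CircuitGraph.not_adj_of_output ⟨w, hw, rfl⟩
      rw [this]
      simp

namespace CircuitGraph

variable {ι ο : Type}

/-- A gate is live if there is a directed path from it to an output. -/
def Live (c : CircuitGraph ι ο) (g : c.Gate) : Prop :=
  ∃ o h, c.outputSource o = .inr h ∧ Relation.ReflTransGen c.Feeds g h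

/-- Removal of all gates that are not live. Valuations and ranks are inherited along the map `emb`,
which sends the nodes of the smaller graph to those of the larger one. -/
theorem exists_live (c : CircuitGraph ι ο) :
    ∃ (c' : CircuitGraph ι ο) (emb : ι ⊕ c'.Gate → ι ⊕ c.Gate),
      (∀ g, c'.Live g) ∧ c'.size ≤ c.size ∧ c'.fanOut ≤ c.fanOut ∧
      (∀ V, c.IsValuation V → c'.IsValuation (V ∘ emb)) ∧
      (∀ o, emb (c'.outputSource o) = c.outputSource o) ∧
      ∀ rank : ι ⊕ c.Gate → ℕ, (∀ g i, rank (c.operand g i) < rank (.inr g)) →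
        ∀ g i, rank (emb (c'.operand g i)) < rank (emb (.inr g)) := by
  have := c.finite_gate
  let emb : ι ⊕ {g // c.Live g} → ι ⊕ c.Gate := Sum.map id Subtype.val
  have emb_inj : Function.Injective emb := Function.injective_id.sumMap Subtype.val_injective
  have hop : ∀ (g : {g // c.Live g}) (i : Fin (c.kind g.1).arity),
      ∃ u, emb u = c.operand g.1 i := by
    rintro ⟨g, o, h, ho, hg⟩ i
    rcases hi : c.operand g i with j | g'
    · exact ⟨.inl j, rfl⟩
    · exact ⟨.inr ⟨g', o, h, ho, .head ⟨i, hi⟩ hg⟩, rfl⟩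
  have hout : ∀ o, ∃ u, emb u = c.outputSource o := by
    intro o
    rcases ho : c.outputSource o with j | g'
    · exact ⟨.inl j, rfl⟩
    · exact ⟨.inr ⟨g', o, g', ho, .refl⟩, rfl⟩
  choose op' hop' using hop
  choose out' hout' using hout
  let c' : CircuitGraph ι ο := ⟨{g // c.Live g}, inferInstance, fun g => c.kind g.1, op', out'⟩
  refine ⟨c', emb, ?_, Finite.card_subtype_le _, ?_, ?_, hout', ?_⟩
  · rintro ⟨g, o, h, ho, hg⟩
    have key : ∀ hl : c.Live g, ∃ h' : {g // c.Live g}, h'.1 = h ∧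
        Relation.ReflTransGen c'.Feeds ⟨g, hl⟩ h' := by
      induction hg using Relation.ReflTransGen.head_induction_on with
      | refl => exact fun hl => ⟨⟨h, hl⟩, rfl, .refl⟩
      | head hgg' hg' ih =>
        intro hl
        obtain ⟨h', hh', hr⟩ := ih ⟨o, h, ho, hg'⟩
        obtain ⟨i, hi⟩ := hgg'
        refine ⟨h', hh', .head ⟨i, emb_inj ?_⟩ hr⟩
        exact (hop' ⟨_, _⟩ i).trans hi
    obtain ⟨h', rfl, hr⟩ := key ⟨o, h, ho, hg⟩
    exact ⟨o, h', emb_inj ((hout' o).trans ho), hr⟩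
  · refine iSup_le fun v => ?_
    rcases v with u | o
    · let φ : c'.Wire → c.Wire := Sum.map (fun w => ⟨w.1.1, w.2⟩) id
      have hφ : Function.Injective φ := by
        refine Function.Injective.sumMap ?_ Function.injective_id
        rintro ⟨⟨g, hg⟩, i⟩ ⟨⟨g', hg'⟩, i'⟩ h
        simp only [Sigma.mk.injEq] at h
        obtain ⟨rfl, h⟩ := h
        obtain rfl := eq_of_heq h
        rfl
      rw [← hφ.encard_image]
      refine (Set.encard_le_encard ?_).trans
        (le_iSup (fun v => Set.encard {w : c.Wire | c.wireSource w = v}) (.inl (emb u)))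
      rintro _ ⟨w | w, hw, rfl⟩
      · have hw' : op' w.1 w.2 = u := Sum.inl_injective hw
        change Sum.inl (c.operand w.1.1 w.2) = Sum.inl (emb u)
        rw [← hw', hop']
      · have hw' : out' w = u := Sum.inl_injective hw
        change Sum.inl (c.outputSource w) = Sum.inl (emb u)
        rw [← hw', hout']
    · have : {w : c'.Wire | c'.wireSource w = .inr o} = ∅ :=
        Set.eq_empty_of_forall_notMem fun w hw => not_adj_of_output ⟨w, hw, rfl⟩
      rw [this]
      simp
  · rintro V ⟨hV, hV'⟩
    refine ⟨hV, fun g x => (hV' g.1 x).trans ?_⟩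
    change _ = (c.kind g.1).eval fun i => V (emb (op' g i)) x
    simp only [hop']
  · intro rank hrank g i
    change rank (emb (op' g i)) < _
    rw [hop']
    exact hrank g.1 i

variable {c : CircuitGraph ι ο}

theorem adj_rank_lt {rank : ι ⊕ c.Gate → ℕ} {D : ℕ}
    (hrank : ∀ g i, rank (c.operand g i) < rank (.inr g))
    (hD : ∀ o, rank (c.outputSource o) ≤ D) (u v : c.Vertex) (huv : c.Adj u v) :
    Sum.elim (Sum.elim (fun _ => 0) fun g => rank (.inr g)) (fun _ => D + 1) u <
      Sum.elim (Sum.elim (fun _ => 0) fun g => rank (.inr g)) (fun _ => D + 1) v := by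
  have h0 : ∀ w : ι ⊕ c.Gate, Sum.elim (fun _ => 0) (fun g => rank (.inr g)) w ≤ rank w := by
    rintro (w | w) <;> simp
  rcases v with (i | g) | o
  · exact absurd huv (not_adj_input _ _)
  · obtain ⟨i, rfl⟩ := exists_of_adj_gate huv
    exact (h0 _).trans_lt (hrank g i)
  · rw [exists_of_adj_output huv]
    exact ((h0 _).trans (hD o)).trans_lt (Nat.lt_succ_self D)

theorem acyclic_of_rank {ρ : c.Vertex → ℕ} (h : ∀ u v, c.Adj u v → ρ u < ρ v) : c.Acyclic := by
  intro v hv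
  have : ∀ u, Relation.TransGen c.Adj v u → ρ v < ρ u := by
    intro u hu
    induction hu with
    | single huv => exact h _ _ huv
    | tail _ huv ih => exact ih.trans (h _ _ huv)
  exact lt_irrefl _ (this v hv)

theorem exists_reaches (hc : c.Acyclic) (u : ι ⊕ c.Gate) : ∃ i, c.Reaches i (.inl u) := by
  rcases u with i | g
  · exact ⟨i, .refl⟩
  · induction g using hc.wellFounded_feeds.induction with
    | _ g ih =>
      have hadj := adj_operand g ⟨0, (c.kind g).arity_pos⟩
      rcases hk : c.operand g ⟨0, (c.kind g).arity_pos⟩ with i | g'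
      · exact ⟨i, .single (hk ▸ hadj)⟩
      · obtain ⟨i, hi⟩ := ih g' ⟨_, hk⟩
        exact ⟨i, hi.tail (hk ▸ hadj)⟩

/-- Every node is reached from an input; hence the graph is connected if some output is reached
from all inputs. -/
theorem connected_of_reaches (hc : c.Acyclic) (o : ο) (h : ∀ i, c.Reaches i (.inr o)) :
    (SimpleGraph.fromRel c.Adj).Connected := by
  have reach : ∀ u v, Relation.ReflTransGen c.Adj u v →
      (SimpleGraph.fromRel c.Adj).Reachable u v := by
    intro u v huv
    induction huv with
    | refl => exact .refl u
    | tail _ hbc ih =>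
      refine ih.trans (SimpleGraph.Adj.reachable ?_)
      rw [SimpleGraph.fromRel_adj]
      refine ⟨?_, .inl hbc⟩
      rintro rfl
      exact hc _ (.single hbc)
  have key : ∀ v, (SimpleGraph.fromRel c.Adj).Reachable v (.inr o) := by
    intro v
    obtain ⟨i, hi⟩ : ∃ i, c.Reaches i v := by
      rcases v with u | o'
      · exact exists_reaches hc u
      · obtain ⟨i, hi⟩ := exists_reaches hc (c.outputSource o')
        exact ⟨i, hi.tail (adj_outputSource o')⟩
    exact (reach _ _ hi).symm.trans (reach _ _ (h i))
  exact (SimpleGraph.connected_iff _).2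
    ⟨fun u v => (key u).trans (key v).symm, ⟨.inr o⟩⟩

end CircuitGraph

/-- If an output depends on all inputs, then the tokens for the outputs give a logic circuit. -/
theorem Realizable.exists_logicCircuit {ι : Type} {s N D : ℕ} {y : Fin N → (ι → Bool) → Bool}
    (h : Realizable s (∑ o, {(y o, D)})) (o₀ : Fin N)
    (hy : ∀ i, ∃ x x', (∀ j, j ≠ i → x j = x' j) ∧ y o₀ x ≠ y o₀ x') :
    ∃ c : LogicCircuit ι (Fin N), (∀ x o, c.eval x o = y o x) ∧ c.fanOut ≤ 2 ∧
      c.depth ≤ (D + 1 : ℕ) ∧ c.size ≤ s := by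
  obtain ⟨c₁, V₁, rank₁, hs₁, hV₁, hy₁, hr₁, hD₁, hf₁⟩ := h.exists_circuitGraph
  obtain ⟨c, emb, live, hs, hf, hV, hout, hr⟩ := c₁.exists_live
  have hV := hV V₁ hV₁
  have hr : ∀ g i, (rank₁ ∘ emb) (c.operand g i) < (rank₁ ∘ emb) (.inr g) := hr rank₁ hr₁
  have hD : ∀ o, (rank₁ ∘ emb) (c.outputSource o) ≤ D := fun o => by
    simpa [hout] using hD₁ o
  have hy' : ∀ o, (V₁ ∘ emb) (c.outputSource o) = y o := fun o => by simp [hout, hy₁]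
  have hlt := CircuitGraph.adj_rank_lt hr hD
  have hc := CircuitGraph.acyclic_of_rank hlt
  have hreach : ∀ i, c.Reaches i (.inr o₀) := by
    intro i
    obtain ⟨x, x', hx, hne⟩ := hy i
    rw [← hy'] at hne
    exact (hV.reaches hc hx hne).tail (CircuitGraph.adj_outputSource o₀)
  have hgate : ∀ g, (rank₁ ∘ emb) (.inr g) ≤ D := by
    intro g
    obtain ⟨o, g', ho, hg⟩ := live g
    refine le_trans ?_ (hD o)
    rw [ho]
    clear ho
    induction hg with
    | refl => rfl
    | tail _ hbc ih =>
      obtain ⟨i, hi⟩ := hbc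
      have := hr _ i
      rw [hi] at this
      exact ih.trans this.le
  let L : LogicCircuit ι (Fin N) :=
    { c with
      acyclic := hc
      exists_outgoing := by
        rintro (i | g)
        · rcases Relation.ReflTransGen.cases_head (hreach i) with h | ⟨v, ⟨w, hw, -⟩, -⟩
          · simp at h
          · exact ⟨w, hw⟩
        · obtain ⟨o, g', ho, hg⟩ := live g
          rcases Relation.ReflTransGen.cases_head hg with rfl | ⟨h, ⟨i, hi⟩, -⟩
          · exact ⟨.inr o, by simp [CircuitGraph.wireSource, ho]⟩
          · exact ⟨.inl ⟨h, i⟩, by simp [CircuitGraph.wireSource, hi]⟩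
      connected := CircuitGraph.connected_of_reaches hc o₀ hreach }
  refine ⟨L, fun x o => ?_, hf.trans hf₁, ?_, hs.trans hs₁⟩
  · rw [← hy']
    exact CircuitGraph.IsValuation.unique hc L.isValuation_gateValue hV _ x
  · refine CircuitGraph.depth_le_of_rank hlt ?_
    rintro ((i | g) | o)
    · simp
    · exact (hgate g).trans (Nat.le_succ D)
    · simp

/-! ### Adders -/

section Adder

variable {n : ℕ}

/-- The digit with weight `2 ^ i` of the first number; `false` for `n ≤ i`. -/
def leftBit (n i : ℕ) (x : Fin n ⊕ Fin n → Bool) : Bool :=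
  if h : i < n then x (.inl ⟨i, h⟩) else false

/-- The digit with weight `2 ^ i` of the second number; `false` for `n ≤ i`. -/
def rightBit (n i : ℕ) (x : Fin n ⊕ Fin n → Bool) : Bool :=
  if h : i < n then x (.inr ⟨i, h⟩) else false

/-- Position `i` generates a carry. -/
def generateBit (n i : ℕ) (x : Fin n ⊕ Fin n → Bool) : Bool := leftBit n i x && rightBit n i x

/-- Position `i` propagates a carry (and does not generate one). -/
def propagateBit (n i : ℕ) (x : Fin n ⊕ Fin n → Bool) : Bool :=
  Bool.xor (leftBit n i x) (rightBit n i x)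

/-- The digit with weight `2 ^ o` of the sum, for `o ≤ n`. -/
def outputBit (n o : ℕ) : (Fin n ⊕ Fin n → Bool) → Bool :=
  if o < n then sumBit (generateBit n) (propagateBit n) (fun _ => false) 0 o
  else blockGenerate (generateBit n) (propagateBit n) 0 n

theorem ofBits_outputBit (a b : Fin n → Bool) :
    Nat.ofBits (fun o : Fin (n + 1) => outputBit n o (Sum.elim a b)) =
      Nat.ofBits a + Nat.ofBits b := by
  have ha : Nat.ofBits a =
      ∑ i ∈ Finset.range n, (leftBit n i (Sum.elim a b)).toNat * 2 ^ i := by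
    rw [← Nat.ofBits_eq_sum fun i => leftBit n i (Sum.elim a b)]
    simp [leftBit]
  have hb : Nat.ofBits b =
      ∑ i ∈ Finset.range n, (rightBit n i (Sum.elim a b)).toNat * 2 ^ i := by
    rw [← Nat.ofBits_eq_sum fun i => rightBit n i (Sum.elim a b)]
    simp [rightBit]
  rw [Nat.ofBits_eq_sum fun o => outputBit n o (Sum.elim a b), ha, hb, ← sum_range_xor_carry,
    Finset.sum_range_succ]
  congr 1
  · refine Finset.sum_congr rfl fun i hi => ?_
    rw [Finset.mem_range] at hi
    simp only [outputBit, if_pos hi, sumBit, zero_add]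
    rfl
  · simp only [outputBit, lt_irrefl, if_false]
    rfl

theorem realizable_bitTokens (n : ℕ) :
    Realizable (3 * n) (∑ i ∈ Finset.range n, bitTokens (generateBit n) (propagateBit n) 2 i) := by
  have h₀ := realizable_inputs (Fin n ⊕ Fin n)
  have e : ∑ i : Fin n ⊕ Fin n, 2 • ({(fun x => x i, 0)} : Multiset (Token (Fin n ⊕ Fin n))) =
      ∑ i ∈ Finset.range n, (2 • {(leftBit n i, 0)} + 2 • {(rightBit n i, 0)}) := by
    rw [Fintype.sum_sum_type, Finset.sum_add_distrib, ← Fin.sum_univ_eq_sum_range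
      (fun i => 2 • ({(leftBit n i, 0)} : Multiset (Token (Fin n ⊕ Fin n)))),
      ← Fin.sum_univ_eq_sum_range
      (fun i => 2 • ({(rightBit n i, 0)} : Multiset (Token (Fin n ⊕ Fin n))))]
    have hl (i : Fin n) : leftBit n i = fun x => x (.inl i) := by funext x; simp [leftBit]
    have hr (i : Fin n) : rightBit n i = fun x => x (.inr i) := by funext x; simp [rightBit]
    simp only [hl, hr]
  rw [e] at h₀
  have bit (i : ℕ) : Derives 3 (2 • {(leftBit n i, 0)} + 2 • {(rightBit n i, 0)})
      (bitTokens (generateBit n) (propagateBit n) 2 i) := by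
    have hp : Derives 2 ({(leftBit n i, 0)} + {(rightBit n i, 0)})
        (3 • {(propagateBit n i, 2)}) := by
      have h := (Derives.xor (leftBit n i) (rightBit n i) (le_refl 0) (le_refl 0)).trans
        ((Derives.of_eq (two_nsmul _)).trans ((Derives.buf (propagateBit n i) 1).add
          (Derives.delay (propagateBit n i) one_le_two)))
      exact h
    have hg : Derives 1 ({(leftBit n i, 0)} + {(rightBit n i, 0)})
        (2 • {(generateBit n i, 2)}) :=
      (Derives.and (leftBit n i) (rightBit n i) (le_refl 0) (le_refl 0)).trans
        ((Derives.delay (generateBit n i) one_le_two).nsmul 2)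
    refine (Derives.of_eq ?_).trans (hp.add hg) |>.mono (by omega)
    rw [← nsmul_add, two_nsmul]
  have h := Derives.sum (Finset.range n) fun i _ => bit i
  have := h 0 0 (by simpa using h₀)
  simpa [mul_comm] using this

theorem Nat.two_pow_le_ofBits_iff (y : Fin (n + 1) → Bool) :
    2 ^ n ≤ Nat.ofBits y ↔ y (Fin.last n) = true := by
  have h₁ := Nat.testBit_ofBits_lt y n (Nat.lt_succ_self n)
  have h₂ := Nat.ofBits_lt_two_pow y
  have h₃ : y (Fin.last n) = (Nat.ofBits y).testBit n := h₁.symm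
  rw [h₃, Nat.testBit_eq_decide_div_mod_eq, decide_eq_true_eq]
  have h₄ : Nat.ofBits y / 2 ^ n < 2 := Nat.div_lt_of_lt_mul (by rwa [← pow_succ])
  rw [Nat.mod_eq_of_lt h₄, ← Nat.one_le_div_iff (by positivity)]
  omega

theorem Nat.ofBits_true (n : ℕ) : Nat.ofBits (fun _ : Fin n => true) + 1 = 2 ^ n := by
  rw [Nat.ofBits_eq_sum fun _ => true]
  induction n with
  | zero => simp
  | succ n ih =>
    rw [Finset.sum_range_succ, pow_succ]
    simp only [Bool.toNat_true, one_mul] at ih ⊢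
    omega

theorem Nat.ofBits_false (n : ℕ) : Nat.ofBits (fun _ : Fin n => false) = 0 := by
  rw [Nat.ofBits_eq_sum fun _ => false]
  simp

theorem Nat.ofBits_single_pos (j : Fin n) : 0 < Nat.ofBits (fun k => decide (k = j)) := by
  refine Nat.pos_of_ne_zero fun h => ?_
  have := Nat.testBit_ofBits_lt (fun k => decide (k = j)) j j.2
  rw [h] at this
  simp at this

/-- The last digit of the sum depends on all digits of both numbers: if one of the numbers is
`2 ^ n - 1`, then there is a carry if and only if the other one is not zero. -/
theorem adder_sensitive (y : Fin (n + 1) → (Fin n ⊕ Fin n → Bool) → Bool)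
    (hy : ∀ a b, Nat.ofBits (fun o => y o (Sum.elim a b)) = Nat.ofBits a + Nat.ofBits b)
    (i : Fin n ⊕ Fin n) :
    ∃ x x', (∀ j, j ≠ i → x j = x' j) ∧ y (Fin.last n) x ≠ y (Fin.last n) x' := by
  have h₁ := Nat.ofBits_true n
  have h₀ := Nat.ofBits_false n
  have key : ∀ a b a' b', 2 ^ n ≤ Nat.ofBits a + Nat.ofBits b →
      ¬ 2 ^ n ≤ Nat.ofBits a' + Nat.ofBits b' →
      y (Fin.last n) (Sum.elim a b) ≠ y (Fin.last n) (Sum.elim a' b') := by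
    intro a b a' b' h h' he
    rw [← hy, Nat.two_pow_le_ofBits_iff] at h h'
    exact h' (he ▸ h)
  rcases i with i | i <;> have h₂ := Nat.ofBits_single_pos i
  · refine ⟨Sum.elim (fun k => decide (k = i)) fun _ => true,
      Sum.elim (fun _ => false) fun _ => true, ?_, key _ _ _ _ (by omega) (by omega)⟩
    rintro (j | j) hj
    · simpa using hj
    · rfl
  · refine ⟨Sum.elim (fun _ => true) fun k => decide (k = i),
      Sum.elim (fun _ => true) fun _ => false, ?_, key _ _ _ _ (by omega) (by omega)⟩
    rintro (j | j) hj
    · rfl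
    · simpa using hj

theorem exists_adder {h m k M : ℕ} (hM : M * 2 ^ h < n) (hn : n ≤ (M + 1) * 2 ^ h)
    (hm : 1 ≤ m) (hk : M + 1 ≤ (2 ^ m) ^ k) :
    ∃ c : LogicCircuit (Fin n ⊕ Fin n) (Fin (n + 1)), IsAdder n c ∧ c.fanOut ≤ 2 ∧
      c.depth ≤ (k * (m + 1) + 4 * h + 3 * m + 9 : ℕ) ∧
      c.size ≤ 10 * n + (M + 1) * ((10 * k + 4) * (2 ^ m * 2 ^ m * 2 ^ m)) := by
  have h₁ := derives_sumBits (generateBit n) (propagateBit n) 2 hM hn hm hk (3 * n) 0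
    (by simpa using realizable_bitTokens n)
  set D := 2 + k * (m + 1) + 4 * h + 3 * m + 6 with hD
  have e : (∑ i ∈ Finset.range n,
      {(sumBit (generateBit n) (propagateBit n) (fun _ => false) 0 i, D)}) +
      {(blockGenerate (generateBit n) (propagateBit n) 0 n, D)} + 0 =
      ∑ o : Fin (n + 1), ({(outputBit n o, D)} : Multiset (Token (Fin n ⊕ Fin n))) := by
    rw [Fin.sum_univ_eq_sum_range fun o =>
      ({(outputBit n o, D)} : Multiset (Token (Fin n ⊕ Fin n))), Finset.sum_range_succ, add_zero]
    congr 1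
    · refine Finset.sum_congr rfl fun i hi => ?_
      rw [outputBit, if_pos (Finset.mem_range.1 hi)]
    · rw [outputBit, if_neg (lt_irrefl n)]
  rw [e] at h₁
  obtain ⟨c, hc, hf, hd, hs⟩ := h₁.exists_logicCircuit (Fin.last n)
    (adder_sensitive (fun o : Fin (n + 1) => outputBit n o) ofBits_outputBit)
  refine ⟨c, fun a b => ?_, hf, hd.trans ?_, hs.trans (by omega)⟩
  · rw [← ofBits_outputBit]
    congr 1
    funext o
    exact hc _ _
  · exact_mod_cast (by omega : D + 1 ≤ k * (m + 1) + 4 * h + 3 * m + 9)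

theorem exists_adder_size_le (hn : 1 ≤ n) :
    ∃ c : LogicCircuit (Fin n ⊕ Fin n) (Fin (n + 1)), IsAdder n c ∧ c.fanOut ≤ 2 ∧
      (∃ d : ℕ, c.depth = d) ∧ c.size ≤ 42 * n := by
  obtain ⟨c, hc, hf, hd, hs⟩ := exists_adder (n := n) (h := Nat.clog 2 n) (m := 1) (k := 0)
    (M := 0) (by omega) (by simpa using Nat.le_pow_clog one_lt_two n) le_rfl (by simp)
  refine ⟨c, hc, hf, ?_, hs.trans (by omega)⟩
  obtain ⟨d, hd⟩ := ENat.ne_top_iff_exists.1 (ne_top_of_le_ne_top (ENat.natCast_ne_top _) hd)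
  exact ⟨d, hd.symm⟩

/-- With blocks of `2 ^ (4 * m)` positions, the size of the upper part is linear in `n`; with
`m ≈ log₂ n / k`, its depth exceeds `log₂ n` by a small multiple of `log₂ n / k` only. -/
theorem exists_adder_depth_le {k : ℕ} (hk : 8 ≤ k) (hn : k * k ≤ Nat.clog 2 n) :
    ∃ c : LogicCircuit (Fin n ⊕ Fin n) (Fin (n + 1)), IsAdder n c ∧ c.fanOut ≤ 2 ∧
      c.depth ≤ (Nat.clog 2 n + 19 * (Nat.clog 2 n / k) + 2 * k + 28 : ℕ) ∧
      c.size ≤ 42 * n := by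
  set l := Nat.clog 2 n with hl
  set m := l / k + 1 with hm
  have hl64 : 64 ≤ l := le_trans (Nat.mul_le_mul hk hk) hn
  have hn2 : 2 ≤ n := by
    by_contra hlt
    rw [hl, Nat.clog_of_right_le_one (by omega)] at hl64
    omega
  have hkm : k ≤ m := by
    have := (Nat.le_div_iff_mul_le (by omega : 0 < k)).2 hn
    omega
  have hmk : m * k ≤ l + k := by
    rw [hm, add_mul, one_mul]
    have := Nat.div_mul_le_self l k
    omega
  have hlk : l ≤ m * k := by
    have := Nat.lt_mul_div_succ l (by omega : 0 < k)
    rw [mul_comm m]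
    exact this.le
  have h4m : 2 ^ (4 * m) ≤ n := by
    have h₁ : l / k ≤ l / 8 := Nat.div_le_div_left hk (by norm_num)
    have h₂ : 2 ^ (l - 1) < n := Nat.pow_pred_clog_lt_self one_lt_two hn2
    exact (Nat.pow_le_pow_right (by norm_num) (by omega)).trans h₂.le
  have hpos : 0 < 2 ^ (4 * m) := by positivity
  set M := (n - 1) / 2 ^ (4 * m) with hM
  have hM₁ : M * 2 ^ (4 * m) < n := by
    have := Nat.div_mul_le_self (n - 1) (2 ^ (4 * m))
    rw [← hM] at this
    omega
  have hM₂ : n ≤ (M + 1) * 2 ^ (4 * m) := by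
    have := Nat.lt_div_mul_add (a := n - 1) hpos
    rw [← hM] at this
    rw [add_mul, one_mul]
    omega
  have hM₃ : M + 1 ≤ (2 ^ m) ^ k := by
    have h₁ : M * 1 ≤ M * 2 ^ (4 * m) := Nat.mul_le_mul_left _ hpos
    rw [← pow_mul]
    calc M + 1 ≤ n := by omega
      _ ≤ 2 ^ l := Nat.le_pow_clog one_lt_two n
      _ ≤ 2 ^ (m * k) := Nat.pow_le_pow_right (by norm_num) hlk
  obtain ⟨c, hc, hf, hd, hs⟩ := exists_adder hM₁ hM₂ (by omega) hM₃
  refine ⟨c, hc, hf, hd.trans ?_, hs.trans ?_⟩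
  · have : k * (m + 1) + 4 * (4 * m) + 3 * m + 9 ≤ l + 19 * (l / k) + 2 * k + 28 := by
      rw [mul_add, mul_comm k m]
      omega
    exact_mod_cast this
  · have h₁ : 10 * k + 4 ≤ 14 * 2 ^ m := by
      have := (Nat.lt_two_pow_self (n := m))
      omega
    have h₂ : 2 ^ (4 * m) = 2 ^ m * (2 ^ m * 2 ^ m * 2 ^ m) := by
      rw [mul_comm 4, pow_mul]
      ring
    have h₃ := Nat.mul_le_mul_left (M + 1) (Nat.mul_le_mul_right (2 ^ m * 2 ^ m * 2 ^ m) h₁)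
    rw [mul_assoc 14, ← h₂] at h₃
    nlinarith

end Adder

/-! ### Depth bounds and the choice of the adders -/

/-- The last output depends on all `2 * n` inputs, so there is a path of length at least
`log₂ (2 * n)` that ends in its source. -/
theorem IsAdder.logb_le_depth {n : ℕ} (hn : 1 ≤ n)
    {c : LogicCircuit (Fin n ⊕ Fin n) (Fin (n + 1))} (hc : IsAdder n c) :
    ∃ k : ℕ, c.depth = (k : ℕ∞) ∧ Real.logb 2 (n : ℝ) ≤ (k : ℝ) := by
  have := c.finite_gate
  obtain ⟨k, hk⟩ := ENat.ne_top_iff_exists.1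
    (ne_top_of_le_ne_top (ENat.natCast_ne_top _) (CircuitGraph.depth_le_card c.acyclic))
  refine ⟨k, hk.symm, ?_⟩
  by_contra! hlt
  have hkn : 2 ^ k < n := by
    rw [Real.lt_logb_iff_rpow_lt one_lt_two (by positivity), Real.rpow_natCast] at hlt
    exact_mod_cast hlt
  have hreach : {i | c.Reaches i (.inl (c.outputSource (Fin.last n)))} = Set.univ := by
    refine Set.eq_univ_of_forall fun i => ?_
    obtain ⟨x, x', hx, hne⟩ := adder_sensitive (fun o x => c.eval x o) hc i
    exact c.isValuation_gateValue.reaches c.acyclic hx hne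
  obtain ⟨p, -, hp⟩ := CircuitGraph.exists_path_of_lt_ncard k
    (c.outputSource (Fin.last n)) (by
      rw [hreach, Set.ncard_univ, Nat.card_eq_fintype_card, Fintype.card_sum, Fintype.card_fin]
      omega)
  have h₁ : (p.length : ℕ∞) ≤ c.depth := le_iSup (fun p : RelSeries
    {e : c.Vertex × c.Vertex | c.Adj e.1 e.2} => (p.length : ℕ∞)) p
  rw [← hk, hp] at h₁
  have : k + 1 ≤ k := by exact_mod_cast h₁
  omega

theorem Real.logb_le_clog (n : ℕ) : Real.logb 2 n ≤ Nat.clog 2 n := by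
  rcases Nat.eq_zero_or_pos n with rfl | hn
  · simp
  · rw [Real.logb_le_iff_le_rpow one_lt_two (by positivity), Real.rpow_natCast]
    exact_mod_cast Nat.le_pow_clog one_lt_two n

theorem Real.clog_le_logb_add_one {n : ℕ} (hn : 1 ≤ n) :
    (Nat.clog 2 n : ℝ) ≤ Real.logb 2 n + 1 := by
  rcases Nat.lt_or_ge 1 n with h | h
  · have h₁ := Nat.pow_pred_clog_lt_self one_lt_two h
    have h₂ : ((Nat.clog 2 n - 1 : ℕ) : ℝ) ≤ Real.logb 2 n := by
      rw [Real.le_logb_iff_rpow_le one_lt_two (by positivity), Real.rpow_natCast]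
      exact_mod_cast h₁.le
    have h₃ : (Nat.clog 2 n : ℝ) ≤ ((Nat.clog 2 n - 1 : ℕ) : ℝ) + 1 := by
      exact_mod_cast (by omega : Nat.clog 2 n ≤ Nat.clog 2 n - 1 + 1)
    linarith
  · obtain rfl : n = 1 := by omega
    simp

theorem mainTheorem1 :
    (∃ d s : ℕ → ℕ,
      (fun n : ℕ => (d n : ℝ) - Real.logb 2 (n : ℝ))
        =o[Filter.atTop] (fun n : ℕ => Real.logb 2 (n : ℝ)) ∧
      (fun n : ℕ => (s n : ℝ)) =O[Filter.atTop] (fun n : ℕ => (n : ℝ)) ∧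
      ∀ n : ℕ, 1 ≤ n →
        ∃ c : LogicCircuit (Fin n ⊕ Fin n) (Fin (n + 1)),
          IsAdder n c ∧ c.fanIn ≤ 2 ∧ c.fanOut ≤ 2 ∧
            c.depth = (d n : ℕ∞) ∧ c.size = s n) ∧
    (∀ n : ℕ, 1 ≤ n → ∀ c : LogicCircuit (Fin n ⊕ Fin n) (Fin (n + 1)), IsAdder n c →
      ∃ k : ℕ, c.depth = (k : ℕ∞) ∧ Real.logb 2 (n : ℝ) ≤ (k : ℝ)) := by
  refine ⟨?_, fun n hn c hc => hc.logb_le_depth hn⟩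
  -- choose adders of minimum depth among those of size at most `42 * n`
  let S (n : ℕ) : Set ℕ := {d | ∃ c : LogicCircuit (Fin n ⊕ Fin n) (Fin (n + 1)),
    IsAdder n c ∧ c.fanOut ≤ 2 ∧ c.depth = d ∧ c.size ≤ 42 * n}
  have hS : ∀ n, 1 ≤ n → (S n).Nonempty := by
    intro n hn
    obtain ⟨c, hc, hf, ⟨d, hd⟩, hs⟩ := exists_adder_size_le hn
    exact ⟨d, c, hc, hf, hd, hs⟩
  have hmin : ∀ n, ∃ s, s ≤ 42 * n ∧ (1 ≤ n →
      ∃ c : LogicCircuit (Fin n ⊕ Fin n) (Fin (n + 1)), IsAdder n c ∧ c.fanOut ≤ 2 ∧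
        c.depth = (sInf (S n) : ℕ) ∧ c.size = s) := by
    intro n
    rcases Nat.eq_zero_or_pos n with rfl | hn
    · exact ⟨0, le_rfl, by omega⟩
    · obtain ⟨c, hc, hf, hd, hs⟩ := Nat.sInf_mem (hS n hn)
      exact ⟨c.size, hs, fun _ => ⟨c, hc, hf, hd, rfl⟩⟩
  choose s hs hc using hmin
  refine ⟨fun n => sInf (S n), s, ?_, ?_, fun n hn => ?_⟩
  · rw [Asymptotics.isLittleO_iff]
    intro ε hε
    obtain ⟨k₀, hk₀⟩ := exists_nat_ge (38 / ε)
    set k := max 8 k₀ with hk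
    have hk8 : 8 ≤ k := le_max_left _ _
    have hkε : 19 / (k : ℝ) ≤ ε / 2 := by
      have h₁ : 38 / ε ≤ k := hk₀.trans (by exact_mod_cast le_max_right _ _)
      rw [div_le_iff₀ hε] at h₁
      rw [div_le_iff₀ (by positivity)]
      linarith
    have hlim : Filter.Tendsto (fun n : ℕ => Real.logb 2 (n : ℝ)) Filter.atTop Filter.atTop :=
      (Real.tendsto_logb_atTop one_lt_two).comp tendsto_natCast_atTop_atTop
    filter_upwards [hlim.eventually_ge_atTop (k * k : ℝ),
      hlim.eventually_ge_atTop ((2 * k + 48) / (ε / 2)), Filter.eventually_ge_atTop 1]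
      with n h₁ h₂ hn
    have hclog : k * k ≤ Nat.clog 2 n := by
      exact_mod_cast h₁.trans (Real.logb_le_clog n)
    have hlow : Real.logb 2 n ≤ (sInf (S n) : ℕ) := by
      obtain ⟨c, hca, -, hd, -⟩ := hc n hn
      obtain ⟨d, hd', hle⟩ := hca.logb_le_depth hn
      rw [hd] at hd'
      have : sInf (S n) = d := by exact_mod_cast hd'
      rwa [this]
    have hup : sInf (S n) ≤ Nat.clog 2 n + 19 * (Nat.clog 2 n / k) + 2 * k + 28 := by
      obtain ⟨c, hca, hf, hd, hsz⟩ := exists_adder_depth_le hk8 hclog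
      obtain ⟨d, hd'⟩ := ENat.ne_top_iff_exists.1 (ne_top_of_le_ne_top (ENat.natCast_ne_top _) hd)
      rw [← hd'] at hd
      have hmem : d ∈ S n := ⟨c, hca, hf, hd'.symm, hsz⟩
      exact (Nat.sInf_le hmem).trans (by exact_mod_cast hd)
    have hlog : 0 ≤ Real.logb 2 n := Real.logb_nonneg one_lt_two (by exact_mod_cast hn)
    have hup' : ((sInf (S n) : ℕ) : ℝ) ≤
        Nat.clog 2 n + 19 * ((Nat.clog 2 n : ℝ) / k) + 2 * k + 28 := by
      have h₃ : ((Nat.clog 2 n / k : ℕ) : ℝ) ≤ (Nat.clog 2 n : ℝ) / k := Nat.cast_div_le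
      have h₄ : ((sInf (S n) : ℕ) : ℝ) ≤
          Nat.clog 2 n + 19 * ((Nat.clog 2 n / k : ℕ) : ℝ) + 2 * k + 28 := by exact_mod_cast hup
      linarith
    have h₅ := Real.clog_le_logb_add_one hn
    have h₆ : 19 * ((Nat.clog 2 n : ℝ) / k) ≤ ε / 2 * Real.logb 2 n + 19 := by
      have hk1 : (1 : ℝ) ≤ k := by exact_mod_cast (by omega : 1 ≤ k)
      calc 19 * ((Nat.clog 2 n : ℝ) / k) ≤ 19 * ((Real.logb 2 n + 1) / k) := by gcongr
        _ = 19 / k * Real.logb 2 n + 19 / k := by ring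
        _ ≤ ε / 2 * Real.logb 2 n + 19 := by
          gcongr
          exact div_le_self (by norm_num) hk1
    rw [div_le_iff₀ (by positivity)] at h₂
    rw [Real.norm_of_nonneg (by linarith), Real.norm_of_nonneg hlog]
    linarith
  · refine Asymptotics.IsBigO.of_bound 42 (Filter.Eventually.of_forall fun n => ?_)
    rw [Real.norm_natCast, Real.norm_natCast]
    exact_mod_cast hs n
  · obtain ⟨c, hca, hf, hd, hsz⟩ := hc n hn
    exact ⟨c, hca, CircuitGraph.fanIn_le_two, hf, hd, hsz⟩
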